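/- **Algorithm.** Input: a matrix $X\in\mathbb R^{n\times m}$ with $\operatorname{rank}(X)=n\ge 1$ and an integer $k$ with $n<k\le m$. 1. Take a thin singular value decomposition $X=U\Sigma V^{T}$, $V\in\mathbb R^{m\times n}$, and let $y_1,\dots,y_m\in\mathbb R^n$ be the rows of $V$. Let $e_1,\dots,e_m$ be the standard basis of $\mathbb R^m$. 2. Run dual-set spectral sparsification on $(y_i)$, $(e_i)$, $k$. Put $\delta=\frac{1+\sqrt{m/k}}{1-\sqrt{n/k}}$, $s=0\in\mathbb R^m$, $A=0_{n\times n}$, $B=0_{m\times m}$. For $\tau=0,1,\dots,k-1$: let $L=\tau-\sqrt{nk}$ and $T=\delta(\tau+\sqrt{mk})$; for each $j$ put $$\mathrm{lo}_j=\frac{y_j^T(A-(L+1)I)^{-2}y_j}{\operatorname{tr}(A-(L+1)I)^{-1}-\operatorname{tr}(A-LI)^{-1}}-y_j^T(A-(L+1)I)^{-1}y_j,$$ $$\mathrm{up}_j=\frac{e_j^T((T+\delta)I-B)^{-2}e_j}{\operatorname{tr}(TI-B)^{-1}-\operatorname{tr}((T+\delta)I-B)^{-1}}+e_j^T((T+\delta)I-B)^{-1}e_j;$$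 pick an index $j$ with $\mathrm{up}_j\le\mathrm{lo}_j$, let $t=2/(\mathrm{up}_j+\mathrm{lo}_j)$, and replace $s_j$ by $s_j+t$, $A$ by $A+t\,y_jy_j^T$, $B$ by $B+t\,e_je_j^T$. At the end multiply $s$ by $\frac1k\bigl(1-\sqrt{n/k}\bigr)$. 3. Return $S=\{i: s_i\ne 0\}$. **Theorem.** Let $X\in\mathbb R^{n\times m}$ with $\operatorname{rank}(X)=n\ge1$ and let $n<k\le m$. The algorithm needs $O(kmn^2)$ operations and deterministically constructs a set $S\subseteq\{1,\dots,m\}$ with $|S|\le k$, $\operatorname{rank}(X_S)=n$ and, for both the spectral norm ($\xi=2$) and the Frobenius norm ($\xi=\mathrm F$), $$\|X_S^{\dagger}\|_\xi^2\le\Bigl(1+\sqrt{m/k}\Bigr)^2\Bigl(1-\sqrt{n/k}\Bigr)^{-2}\|X^{\dagger}\|_\xi^2 ,$$ where $X_S$ consists of the columns of $X$ with index in $S$ and $\dagger$ is the Moore–Penrose pseudo-inverse. In detail: $X$ has a thin singular value decomposition, and for every such decomposition and every admissible choice of the indices $j$, the returned set $S$ has the stated properties. Moreover there are one deterministic real random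 access machine program (exact arithmetic; $+,-,\times,/,\sqrt{\ },\le$ on reals, index arithmetic, assignments and loop iterations at unit cost; no singular value decomposition as a primitive) and an absolute constant $C$ such that, for all $n,m,k,X$ as above, the program stops on input $(X,k)$ after at most $C\,k\,m\,n^2$ operations and returns a set that is a possible output of the algorithm for every choice of the singular value decomposition in step 1. -/

import Mathlib

open scoped Matrix

/-! ### Norms, column submatrices, pseudo-inverse -/

section Matrices

variable {ι κ : Type*} [Fintype ι] [Fintype κ]

/-- The spectral norm, i.e. the operator norm with respect to the Euclidean norms. -/
noncomputable def spectralNorm₂ (A : Matrix ι κ ℝ) : ℝ :=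
  letI := Classical.decEq κ
  ‖(Matrix.toEuclideanLin A).toContinuousLinearMap‖

/-- The Frobenius norm. -/
noncomputable def frobeniusNorm (A : Matrix ι κ ℝ) : ℝ :=
  √(∑ i, ∑ j, A i j ^ 2)

/-- The submatrix of the columns of `X` with index in `S`. -/
def colSubmatrix {m : ℕ} (X : Matrix ι (Fin m) ℝ) (S : Finset (Fin m)) :
    Matrix ι {j // j ∈ S} ℝ :=
  X.submatrix id Subtype.val

/-- The four Penrose equations. -/
structure IsMoorePenrose (A : Matrix ι κ ℝ) (P : Matrix κ ι ℝ) : Prop where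
  mul_mul_self : A * P * A = A
  mul_mul_inv : P * A * P = P
  symm_left : (A * P)ᵀ = A * P
  symm_right : (P * A)ᵀ = P * A

theorem IsMoorePenrose.unique {A : Matrix ι κ ℝ} {P Q : Matrix κ ι ℝ}
    (hP : IsMoorePenrose A P) (hQ : IsMoorePenrose A Q) : P = Q := by
  have h1 : A * P = A * Q := by
    have e : A * P = (A * Q) * (A * P) := by
      rw [← Matrix.mul_assoc, hQ.mul_mul_self]
    have e2 : (A * P)ᵀ = (A * P)ᵀ * (A * Q)ᵀ := by
      conv_lhs => rw [e]
      rw [Matrix.transpose_mul]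
    rw [hP.symm_left, hQ.symm_left, ← Matrix.mul_assoc, hP.mul_mul_self] at e2
    exact e2
  have h2 : P * A = Q * A := by
    have e : P * A = (P * A) * (Q * A) := by
      rw [Matrix.mul_assoc, ← Matrix.mul_assoc A, hQ.mul_mul_self]
    have e2 : (P * A)ᵀ = (Q * A)ᵀ * (P * A)ᵀ := by
      conv_lhs => rw [e]
      rw [Matrix.transpose_mul]
    rw [hP.symm_right, hQ.symm_right, Matrix.mul_assoc, ← Matrix.mul_assoc A,
      hP.mul_mul_self] at e2
    exact e2
  calc P = P * A * P := hP.mul_mul_inv.symm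
    _ = Q * (A * P) := by rw [h2, Matrix.mul_assoc]
    _ = Q * A * Q := by rw [h1, Matrix.mul_assoc]
    _ = Q := hQ.mul_mul_inv

theorem IsMoorePenrose.exists (A : Matrix ι κ ℝ) : ∃ P, IsMoorePenrose A P := by
  classical
  have hH : (Aᵀ * A).IsHermitian := by
    simpa using Matrix.isHermitian_conjTranspose_mul_self A
  set E : Matrix κ κ ℝ := (hH.eigenvectorUnitary : Matrix κ κ ℝ) with hE
  set l := hH.eigenvalues with hl
  have hEE : Eᵀ * E = 1 := by
    have := Matrix.UnitaryGroup.star_mul_self hH.eigenvectorUnitary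
    simpa [Matrix.star_eq_conjTranspose] using this
  have hspec : Aᵀ * A = E * Matrix.diagonal l * Eᵀ := by
    have := hH.spectral_theorem
    simpa [Unitary.conjStarAlgAut_apply, Matrix.star_eq_conjTranspose] using this
  set K := E * Matrix.diagonal (fun i => (l i)⁻¹) * Eᵀ with hK
  have key : ∀ a b : κ → ℝ, (E * Matrix.diagonal a * Eᵀ) * (E * Matrix.diagonal b * Eᵀ)
      = E * Matrix.diagonal (fun i => a i * b i) * Eᵀ := by
    intro a b
    calc _ = E * Matrix.diagonal a * (Eᵀ * E) * (Matrix.diagonal b * Eᵀ) := by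
          simp only [Matrix.mul_assoc]
      _ = _ := by
          rw [hEE, Matrix.mul_one, ← Matrix.mul_assoc, Matrix.mul_assoc E,
            Matrix.diagonal_mul_diagonal]
  have symm : ∀ a : κ → ℝ, (E * Matrix.diagonal a * Eᵀ)ᵀ = E * Matrix.diagonal a * Eᵀ := by
    intro a
    simp [Matrix.transpose_mul, Matrix.mul_assoc]
  have cancel : ∀ x : ℝ, x * x⁻¹ * x = x := fun x => by
    by_cases h : x = 0 <;> simp [h]
  have cancel' : ∀ x : ℝ, x⁻¹ * x * x⁻¹ = x⁻¹ := fun x => by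
    by_cases h : x = 0 <;> simp [h]
  have hHKH : (Aᵀ * A) * K * (Aᵀ * A) = Aᵀ * A := by
    rw [hspec, hK, key, key]; simp only [cancel]
  have hKHK : K * (Aᵀ * A) * K = K := by
    rw [hspec, hK, key, key]; simp only [cancel']
  have hKsymm : Kᵀ = K := symm _
  have hKH : (K * (Aᵀ * A))ᵀ = K * (Aᵀ * A) := by
    rw [hspec, hK, key]; exact symm _
  have hAK : A * (K * (Aᵀ * A)) = A := by
    have hz : (A * (K * (Aᵀ * A)) - A)ᵀ * (A * (K * (Aᵀ * A)) - A) = 0 := by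
      have e1 : (A * (K * (Aᵀ * A)) - A)ᵀ * A = 0 := by
        rw [Matrix.transpose_sub, Matrix.sub_mul, Matrix.transpose_mul, hKH,
          ← hKH, Matrix.transpose_mul, hKsymm, Matrix.transpose_mul, Matrix.transpose_transpose,
          sub_eq_zero]
        rw [Matrix.mul_assoc, hHKH]
      rw [Matrix.mul_sub, ← Matrix.mul_assoc, e1, Matrix.zero_mul, sub_zero]
    have hz' : (A * (K * (Aᵀ * A)) - A)ᴴ * (A * (K * (Aᵀ * A)) - A) = 0 := by simpa using hz
    exact sub_eq_zero.1 (Matrix.conjTranspose_mul_self_eq_zero.1 hz')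
  refine ⟨K * Aᵀ, ?_, ?_, ?_, ?_⟩
  · rw [Matrix.mul_assoc, Matrix.mul_assoc K, hAK]
  · calc K * Aᵀ * A * (K * Aᵀ) = K * (Aᵀ * A) * K * Aᵀ := by simp only [Matrix.mul_assoc]
      _ = _ := by rw [hKHK]
  · simp only [Matrix.transpose_mul, Matrix.transpose_transpose, hKsymm, Matrix.mul_assoc]
  · rw [Matrix.mul_assoc]; exact hKH

/-- The Moore-Penrose pseudo-inverse: the unique solution of the Penrose equations. -/
noncomputable def pinv (A : Matrix ι κ ℝ) : Matrix κ ι ℝ :=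
  Classical.choose (IsMoorePenrose.exists A)

theorem pinv_spec (A : Matrix ι κ ℝ) : IsMoorePenrose A (pinv A) :=
  Classical.choose_spec (IsMoorePenrose.exists A)

end Matrices

/-- `X = U diag(σ) Vᵀ` is a thin singular value decomposition of the `n × m` matrix `X` of
rank `r`. -/
structure IsThinSVD {n m r : ℕ} (X : Matrix (Fin n) (Fin m) ℝ) (U : Matrix (Fin n) (Fin r) ℝ)
    (σ : Fin r → ℝ) (V : Matrix (Fin m) (Fin r) ℝ) : Prop where
  left_orthonormal : Uᵀ * U = 1
  right_orthonormal : Vᵀ * V = 1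
  antitone : Antitone σ
  pos : ∀ i, 0 < σ i
  eq : X = U * Matrix.diagonal σ * Vᵀ

/-- `V` is a matrix of right singular vectors of `X`, for the nonzero singular values. -/
def IsRightSingularMatrix {n m r : ℕ} (X : Matrix (Fin n) (Fin m) ℝ)
    (V : Matrix (Fin m) (Fin r) ℝ) : Prop :=
  ∃ (U : Matrix (Fin n) (Fin r) ℝ) (σ : Fin r → ℝ), IsThinSVD X U σ V

/-! ### Dual set spectral sparsification -/

namespace DualSet

/-- The lower barrier potential `φ(L, A) = tr (A - L I)⁻¹`. -/
noncomputable def lowerPotential {n : ℕ} (L : ℝ) (A : Matrix (Fin n) (Fin n) ℝ) : ℝ :=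
  (A - L • (1 : Matrix (Fin n) (Fin n) ℝ))⁻¹.trace

/-- The upper barrier potential `φ'(T, B) = tr (T I - B)⁻¹`. -/
noncomputable def upperPotential {l : ℕ} (T : ℝ) (B : Matrix (Fin l) (Fin l) ℝ) : ℝ :=
  (T • (1 : Matrix (Fin l) (Fin l) ℝ) - B)⁻¹.trace

/-- With `M = A - (L + δ) I`, the number
`vᵀ M⁻² v / (φ(L + δ, A) - φ(L, A)) - vᵀ M⁻¹ v`. -/
noncomputable def lowerGain {n : ℕ} (v : Fin n → ℝ) (δ : ℝ) (A : Matrix (Fin n) (Fin n) ℝ)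
    (L : ℝ) : ℝ :=
  let N := (A - (L + δ) • (1 : Matrix (Fin n) (Fin n) ℝ))⁻¹
  (v ⬝ᵥ ((N * N) *ᵥ v)) / (lowerPotential (L + δ) A - lowerPotential L A) - v ⬝ᵥ (N *ᵥ v)

/-- With `M = (T + δ) I - B`, the number
`uᵀ M⁻² u / (φ'(T, B) - φ'(T + δ, B)) + uᵀ M⁻¹ u`. -/
noncomputable def upperGain {l : ℕ} (u : Fin l → ℝ) (δ : ℝ) (B : Matrix (Fin l) (Fin l) ℝ)
    (T : ℝ) : ℝ :=
  let N := ((T + δ) • (1 : Matrix (Fin l) (Fin l) ℝ) - B)⁻¹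
  (u ⬝ᵥ ((N * N) *ᵥ u)) / (upperPotential T B - upperPotential (T + δ) B) + u ⬝ᵥ (N *ᵥ u)

/-- The data maintained by the algorithm: the weights `s`, and the matrices
`A = ∑ sᵢ vᵢ vᵢᵀ` and `B = ∑ sᵢ uᵢ uᵢᵀ`. -/
structure State (m n l : ℕ) where
  s : Fin m → ℝ
  A : Matrix (Fin n) (Fin n) ℝ
  B : Matrix (Fin l) (Fin l) ℝ

/-- The upper increment `(1 + √(l/k)) / (1 - √(n/k))`; the lower increment is `1`. -/
noncomputable def upperStep (n l k : ℕ) : ℝ :=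
  (1 + √((l : ℝ) / k)) / (1 - √((n : ℝ) / k))

/-- Iteration number `τ = 0, 1, …, k - 1`. Any index whose upper gain does not exceed its
lower gain may be picked. -/
def IsStep {m n l : ℕ} (v : Fin m → Fin n → ℝ) (u : Fin m → Fin l → ℝ) (k τ : ℕ)
    (st st' : State m n l) : Prop :=
  ∃ j : Fin m,
    let lo := lowerGain (v j) 1 st.A ((τ : ℝ) - √((n : ℝ) * k))
    let up := upperGain (u j) (upperStep n l k) st.B (upperStep n l k * ((τ : ℝ) + √((l : ℝ) * k)))
    let t := ((up + lo) / 2)⁻¹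
    up ≤ lo ∧
    st' = { s := st.s + Pi.single j t
            A := st.A + t • Matrix.vecMulVec (v j) (v j)
            B := st.B + t • Matrix.vecMulVec (u j) (u j) }

/-- `s` is a vector of weights returned by the dual set spectral sparsification algorithm on
`v₁, …, vₘ ∈ ℝⁿ`, `u₁, …, uₘ ∈ ℝˡ` and `k`: start from zero, perform `k` iterations, and rescale. -/
def IsOutput {m n l : ℕ} (v : Fin m → Fin n → ℝ) (u : Fin m → Fin l → ℝ) (k : ℕ)
    (s : Fin m → ℝ) : Prop :=
  ∃ st : ℕ → State m n l,
    st 0 = { s := 0, A := 0, B := 0 } ∧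
    (∀ τ < k, IsStep v u k τ (st τ) (st (τ + 1))) ∧
    s = ((1 - √((n : ℝ) / k)) / k) • (st k).s

end DualSet

/-- `S` is a set returned by the greedy selection algorithm when the right singular vectors
computed in its first line are the columns of `V`: the dual set algorithm is run on the rows of `V`
and the standard basis, and the support of the weights is returned. -/
def IsGreedySelection {m n : ℕ} (V : Matrix (Fin m) (Fin n) ℝ) (k : ℕ) (S : Finset (Fin m)) :
    Prop :=
  ∃ s : Fin m → ℝ,
    DualSet.IsOutput (fun i => V i) (fun i : Fin m => (Pi.single i 1 : Fin m → ℝ)) k s ∧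
    ∀ i, i ∈ S ↔ s i ≠ 0

/-! ### A real random access machine

Programs use natural-number registers (for indices) and two-dimensional arrays of real numbers.
Each evaluation of a literal, register or array cell, each arithmetic operation, square root,
comparison, assignment and loop iteration is charged one unit. -/

namespace RealRAM

/-- Index expressions. -/
inductive NExp where
  | lit (c : ℕ)
  | var (x : ℕ)
  | add (e₁ e₂ : NExp)

/-- Real expressions; `sum x d e` is the sum of `e` over `x = 0, …, d - 1`. -/
inductive RExp where
  | ofNat (e : NExp)
  | cell (a : ℕ) (i j : NExp)
  | add (e₁ e₂ : RExp)
  | sub (e₁ e₂ : RExp)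
  | mul (e₁ e₂ : RExp)
  | div (e₁ e₂ : RExp)
  | sqrt (e : RExp)
  | sum (x : ℕ) (d : NExp) (e : RExp)

/-- Programs; `loop x d c` runs `c` for `x = 0, …, d - 1`. -/
inductive Prog where
  | skip
  | setN (x : ℕ) (e : NExp)
  | setR (a : ℕ) (i j : NExp) (e : RExp)
  | seq (c₁ c₂ : Prog)
  | ifLe (e₁ e₂ : RExp) (c₁ c₂ : Prog)
  | loop (x : ℕ) (d : NExp) (c : Prog)

/-- Contents of the registers and of the arrays (array name, row, column). -/
structure Store where
  reg : ℕ → ℕ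
  arr : ℕ → ℕ → ℕ → ℝ

def Store.setReg (s : Store) (x v : ℕ) : Store :=
  { s with reg := Function.update s.reg x v }

def Store.setCell (s : Store) (a i j : ℕ) (r : ℝ) : Store :=
  { s with arr := fun a' i' j' => if a' = a ∧ i' = i ∧ j' = j then r else s.arr a' i' j' }

def NExp.eval (s : Store) : NExp → ℕ
  | lit c => c
  | var x => s.reg x
  | add e₁ e₂ => e₁.eval s + e₂.eval s

def NExp.cost : NExp → ℕ
  | lit _ => 1
  | var _ => 1
  | add e₁ e₂ => e₁.cost + e₂.cost + 1

noncomputable def RExp.eval : RExp → Store → ℝ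
  | ofNat e, s => (e.eval s : ℝ)
  | cell a i j, s => s.arr a (i.eval s) (j.eval s)
  | add e₁ e₂, s => e₁.eval s + e₂.eval s
  | sub e₁ e₂, s => e₁.eval s - e₂.eval s
  | mul e₁ e₂, s => e₁.eval s * e₂.eval s
  | div e₁ e₂, s => e₁.eval s / e₂.eval s
  | sqrt e, s => √(e.eval s)
  | sum x d e, s => ∑ i ∈ Finset.range (d.eval s), e.eval (s.setReg x i)

def RExp.cost : RExp → Store → ℕ
  | ofNat e, _ => e.cost + 1
  | cell _ i j, _ => i.cost + j.cost + 1
  | add e₁ e₂, s => e₁.cost s + e₂.cost s + 1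
  | sub e₁ e₂, s => e₁.cost s + e₂.cost s + 1
  | mul e₁ e₂, s => e₁.cost s + e₂.cost s + 1
  | div e₁ e₂, s => e₁.cost s + e₂.cost s + 1
  | sqrt e, s => e.cost s + 1
  | sum x d e, s => d.cost + 1 + ∑ i ∈ Finset.range (d.eval s), (e.cost (s.setReg x i) + 2)

open Classical in
/-- The final store and the number of operations performed. -/
noncomputable def Prog.run : Prog → Store → Store × ℕ
  | skip, s => (s, 1)
  | setN x e, s => (s.setReg x (e.eval s), e.cost + 1)
  | setR a i j e, s =>
      (s.setCell a (i.eval s) (j.eval s) (e.eval s), i.cost + j.cost + e.cost s + 1)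
  | seq c₁ c₂, s =>
      let p := c₁.run s
      let q := c₂.run p.1
      (q.1, p.2 + q.2)
  | ifLe e₁ e₂ c₁ c₂, s =>
      let q := if e₁.eval s ≤ e₂.eval s then c₁.run s else c₂.run s
      (q.1, e₁.cost s + e₂.cost s + 1 + q.2)
  | loop x d c, s =>
      (List.range (d.eval s)).foldl
        (fun p i =>
          let q := c.run (p.1.setReg x i)
          (q.1, p.2 + q.2 + 1))
        (s, d.cost + 1)

/-- The initial store: `n`, `m`, `k` in the registers `0`, `1`, `2`, the matrix `X` in array `0`,
and zeros everywhere else. -/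
noncomputable def initStore {n m : ℕ} (X : Matrix (Fin n) (Fin m) ℝ) (k : ℕ) : Store where
  reg x := if x = 0 then n else if x = 1 then m else if x = 2 then k else 0
  arr a i j := if h : a = 0 ∧ i < n ∧ j < m then X ⟨i, h.2.1⟩ ⟨j, h.2.2⟩ else 0

open Classical in
/-- The set returned by a program: the indices of the nonzero entries of column `0` of array `1`. -/
noncomputable def Prog.output (P : Prog) {n m : ℕ} (X : Matrix (Fin n) (Fin m) ℝ) (k : ℕ) :
    Finset (Fin m) :=
  Finset.univ.filter fun j => (P.run (initStore X k)).1.arr 1 j 0 ≠ 0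

/-- The number of operations performed on input `X`, `k`. -/
noncomputable def Prog.opCount (P : Prog) {n m : ℕ} (X : Matrix (Fin n) (Fin m) ℝ) (k : ℕ) : ℕ :=
  (P.run (initStore X k)).2

end RealRAM

/-!
The greedy step keeps two barriers apart: `A - L I` and `T I - B` stay positive definite, and their
trace potentials never increase. Summed over all indices, the lower gains dominate the upper gains
by the choice of the two increments, so an admissible index exists; adding `t vⱼ vⱼᵀ` and
`t uⱼ uⱼᵀ` with `1 / t` between the two gains preserves both potentials by the Sherman–Morrison
formula. After `k` steps `A ≥ k (1 - √(n/k)) I`, while each weight is at most the final upper level.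
Dropping the weights therefore bounds `X Xᵀ` by a multiple of `X_S X_Sᵀ`, and such a bound on the
quadratic forms transfers to the pseudo-inverses in both norms.

The machine never needs `V`. Write `X = R Vᵀ` with `R` invertible: then `X diag(s - c) Xᵀ` is
`R (A - c I) Rᵀ`, and conjugation by `R` does not change the lower gains, so they can be read off
`X`, whatever decomposition was chosen. The matrices to invert are positive definite, so inserting
their rows into the identity one at a time passes through invertible matrices only, and each
insertion is a rank one update of the inverse.
-/

/-! ### Orthogonal diagonalization -/

section Orthogonal

open Matrix

variable {ι : Type*} [Fintype ι] [DecidableEq ι] {E : Matrix ι ι ℝ}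

theorem orthogonal_conj_mul (hE : Eᵀ * E = 1) (M N : Matrix ι ι ℝ) :
    (E * M * Eᵀ) * (E * N * Eᵀ) = E * (M * N) * Eᵀ :=
  calc
    _ = E * M * (Eᵀ * E) * (N * Eᵀ) := by simp only [Matrix.mul_assoc]
    _ = E * (M * N) * Eᵀ := by rw [hE, Matrix.mul_one]; simp only [Matrix.mul_assoc]

theorem orthogonal_conj_diagonal_add_smul_one (hE : Eᵀ * E = 1) (d : ι → ℝ) (c : ℝ) :
    E * diagonal d * Eᵀ + c • (1 : Matrix ι ι ℝ) = E * diagonal (fun i => d i + c) * Eᵀ := by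
  rw [← diagonal_add, ← smul_one_eq_diagonal c, Matrix.mul_add, Matrix.add_mul, Matrix.mul_smul,
    Matrix.smul_mul, Matrix.mul_one, mul_eq_one_comm.1 hE]

theorem orthogonal_conj_diagonal_sub_smul_one (hE : Eᵀ * E = 1) (d : ι → ℝ) (c : ℝ) :
    E * diagonal d * Eᵀ - c • (1 : Matrix ι ι ℝ) = E * diagonal (fun i => d i - c) * Eᵀ := by
  simpa only [neg_smul, ← sub_eq_add_neg] using orthogonal_conj_diagonal_add_smul_one hE d (-c)

theorem orthogonal_conj_diagonal_inv (hE : Eᵀ * E = 1) {d : ι → ℝ} (hd : ∀ i, d i ≠ 0) :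
    (E * diagonal d * Eᵀ)⁻¹ = E * diagonal (fun i => (d i)⁻¹) * Eᵀ := by
  refine Matrix.inv_eq_right_inv ?_
  simp [orthogonal_conj_mul hE, hd, mul_eq_one_comm.1 hE]

theorem trace_orthogonal_conj (hE : Eᵀ * E = 1) (M : Matrix ι ι ℝ) :
    (E * M * Eᵀ).trace = M.trace := by
  rw [Matrix.trace_mul_comm, ← Matrix.mul_assoc, hE, Matrix.one_mul]

theorem trace_inv_orthogonal_conj_diagonal (hE : Eᵀ * E = 1) {d : ι → ℝ} (hd : ∀ i, d i ≠ 0) :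
    (E * diagonal d * Eᵀ)⁻¹.trace = ∑ i, (d i)⁻¹ := by
  rw [orthogonal_conj_diagonal_inv hE hd, trace_orthogonal_conj hE, trace_diagonal]

theorem trace_inv_mul_inv_orthogonal_conj_diagonal (hE : Eᵀ * E = 1) {d : ι → ℝ}
    (hd : ∀ i, d i ≠ 0) :
    ((E * diagonal d * Eᵀ)⁻¹ * (E * diagonal d * Eᵀ)⁻¹).trace = ∑ i, (d i)⁻¹ * (d i)⁻¹ := by
  rw [orthogonal_conj_diagonal_inv hE hd, orthogonal_conj_mul hE, diagonal_mul_diagonal,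
    trace_orthogonal_conj hE, trace_diagonal]

theorem posDef_orthogonal_conj_diagonal_iff (hE : Eᵀ * E = 1) {d : ι → ℝ} :
    (E * diagonal d * Eᵀ).PosDef ↔ ∀ i, 0 < d i := by
  rw [← conjTranspose_eq_transpose_of_trivial, ← star_eq_conjTranspose,
    Matrix.IsUnit.posDef_star_right_conjugate_iff (IsUnit.of_mul_eq_one_right _ hE),
    posDef_diagonal_iff]

theorem exists_orthogonal_diagonalization {A : Matrix ι ι ℝ} (hA : A.IsHermitian) :
    ∃ (E : Matrix ι ι ℝ) (l : ι → ℝ), Eᵀ * E = 1 ∧ A = E * diagonal l * Eᵀ := by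
  refine ⟨hA.eigenvectorUnitary, hA.eigenvalues, ?_, ?_⟩
  · simpa [star_eq_conjTranspose] using UnitaryGroup.star_mul_self hA.eigenvectorUnitary
  · simpa [Unitary.conjStarAlgAut_apply, star_eq_conjTranspose] using hA.spectral_theorem

theorem exists_posDef_diagonalization {A : Matrix ι ι ℝ} (hA : A.PosDef) :
    ∃ (E : Matrix ι ι ℝ) (l : ι → ℝ),
      Eᵀ * E = 1 ∧ A = E * diagonal l * Eᵀ ∧ ∀ i, 0 < l i := by
  obtain ⟨E, l, hE, rfl⟩ := exists_orthogonal_diagonalization hA.1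
  exact ⟨E, l, hE, rfl, (posDef_orthogonal_conj_diagonal_iff hE).1 hA⟩

end Orthogonal

/-! ### Shifting the spectrum of a positive definite matrix -/

section Averaging

variable {ι : Type*} [Fintype ι] {δ : ℝ}

theorem sum_inv_gap_mul_le {a : ι → ℝ} (hδ : 0 < δ) (ha : ∀ i, δ < a i)
    (hsum : ∑ i, (a i)⁻¹ ≤ δ⁻¹) :
    (δ⁻¹ - ∑ i, (a i)⁻¹ + ∑ i, (a i - δ)⁻¹) * (∑ i, (a i - δ)⁻¹ - ∑ i, (a i)⁻¹)
      ≤ ∑ i, (a i - δ)⁻¹ * (a i - δ)⁻¹ := by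
  have ha0 : ∀ i, 0 < a i := fun i => hδ.trans (ha i)
  have haδ : ∀ i, 0 < a i - δ := fun i => sub_pos.2 (ha i)
  set F := ∑ i, (a i * (a i - δ) ^ 2)⁻¹
  have diff_eq : ∑ i, (a i - δ)⁻¹ - ∑ i, (a i)⁻¹ = δ * ∑ i, (a i * (a i - δ))⁻¹ := by
    rw [← Finset.sum_sub_distrib, Finset.mul_sum]
    refine Finset.sum_congr rfl fun i _ => ?_
    have := (ha0 i).ne'; have := (haδ i).ne'
    field_simp; ring
  have sq_eq : ∑ i, (a i - δ)⁻¹ * (a i - δ)⁻¹ = ∑ i, (a i * (a i - δ))⁻¹ + δ * F := by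
    rw [Finset.mul_sum, ← Finset.sum_add_distrib]
    refine Finset.sum_congr rfl fun i _ => ?_
    have := (ha0 i).ne'; have := (haδ i).ne'
    field_simp; ring
  have cauchy_schwarz : (∑ i, (a i * (a i - δ))⁻¹) ^ 2 ≤ (∑ i, (a i)⁻¹) * F := by
    refine Finset.sum_sq_le_sum_mul_sum_of_sq_le_mul _ (fun i _ => (inv_pos.2 (ha0 i)).le)
      (fun i _ => (inv_pos.2 (mul_pos (ha0 i) (pow_pos (haδ i) 2))).le) fun i _ => le_of_eq ?_
    have := (ha0 i).ne'; have := (haδ i).ne'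
    field_simp
  have hF : 0 ≤ F :=
    Finset.sum_nonneg fun i _ => (inv_pos.2 (mul_pos (ha0 i) (pow_pos (haδ i) 2))).le
  have sq_le : δ * (∑ i, (a i * (a i - δ))⁻¹) ^ 2 ≤ F :=
    calc
      _ ≤ δ * (δ⁻¹ * F) := by gcongr; exact cauchy_schwarz.trans (by gcongr)
      _ = F := mul_inv_cancel_left₀ hδ.ne' F
  rw [sub_add_eq_add_sub, add_sub_assoc, diff_eq, sq_eq, add_mul, inv_mul_cancel_left₀ hδ.ne']
  nlinarith [mul_le_mul_of_nonneg_left sq_le hδ.le]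

theorem sum_inv_add_mul_inv_add_le {b : ι → ℝ} (hδ : 0 < δ) (hb : ∀ i, 0 < b i) :
    ∑ i, (b i + δ)⁻¹ * (b i + δ)⁻¹ ≤ δ⁻¹ * (∑ i, (b i)⁻¹ - ∑ i, (b i + δ)⁻¹) := by
  rw [← Finset.sum_sub_distrib, Finset.mul_sum]
  refine Finset.sum_le_sum fun i _ => ?_
  have h : δ⁻¹ * ((b i)⁻¹ - (b i + δ)⁻¹) = (b i)⁻¹ * (b i + δ)⁻¹ := by
    have := (hb i).ne'; have := (add_pos (hb i) hδ).ne'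
    field_simp; ring
  rw [h]
  have := add_pos (hb i) hδ
  gcongr
  · exact hb i
  · linarith

end Averaging

section Shift

open Matrix

variable {ι : Type*} [Fintype ι] [DecidableEq ι] {M : Matrix ι ι ℝ} {δ : ℝ}

theorem exists_diagonalization_lt_of_trace_inv_lt (hM : M.PosDef) (hδ : 0 < δ)
    (hφ : M⁻¹.trace < δ⁻¹) :
    ∃ (E : Matrix ι ι ℝ) (l : ι → ℝ),
      Eᵀ * E = 1 ∧ M = E * diagonal l * Eᵀ ∧ ∀ i, δ < l i := by
  obtain ⟨E, l, hE, rfl, hl⟩ := exists_posDef_diagonalization hM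
  refine ⟨E, l, hE, rfl, fun i => ?_⟩
  rw [trace_inv_orthogonal_conj_diagonal hE fun i => (hl i).ne'] at hφ
  have hi : (l i)⁻¹ ≤ ∑ i, (l i)⁻¹ :=
    Finset.single_le_sum (f := fun i => (l i)⁻¹) (fun j _ => (inv_pos.2 (hl j)).le)
      (Finset.mem_univ i)
  exact (inv_lt_inv₀ (hl i) hδ).1 (hi.trans_lt hφ)

theorem posDef_sub_smul_one_of_trace_inv_lt (hM : M.PosDef) (hδ : 0 < δ)
    (hφ : M⁻¹.trace < δ⁻¹) : (M - δ • (1 : Matrix ι ι ℝ)).PosDef := by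
  obtain ⟨E, l, hE, rfl, hl⟩ := exists_diagonalization_lt_of_trace_inv_lt hM hδ hφ
  rw [orthogonal_conj_diagonal_sub_smul_one hE, posDef_orthogonal_conj_diagonal_iff hE]
  exact fun i => sub_pos.2 (hl i)

theorem trace_inv_add_smul_one_lt [Nonempty ι] (hM : M.PosDef) (hδ : 0 < δ) :
    (M + δ • (1 : Matrix ι ι ℝ))⁻¹.trace < M⁻¹.trace := by
  obtain ⟨E, l, hE, rfl, hl⟩ := exists_posDef_diagonalization hM
  rw [orthogonal_conj_diagonal_add_smul_one hE,
    trace_inv_orthogonal_conj_diagonal hE fun i => (add_pos (hl i) hδ).ne',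
    trace_inv_orthogonal_conj_diagonal hE fun i => (hl i).ne']
  exact Finset.sum_lt_sum_of_nonempty Finset.univ_nonempty fun i _ =>
    inv_strictAnti₀ (hl i) (lt_add_of_pos_right _ hδ)

theorem trace_inv_lt_trace_inv_sub_smul_one [Nonempty ι] (hM : M.PosDef) (hδ : 0 < δ)
    (hφ : M⁻¹.trace < δ⁻¹) : M⁻¹.trace < (M - δ • (1 : Matrix ι ι ℝ))⁻¹.trace := by
  simpa using trace_inv_add_smul_one_lt (posDef_sub_smul_one_of_trace_inv_lt hM hδ hφ) hδ

theorem inv_sub_trace_inv_le [Nonempty ι] (hM : M.PosDef) (hδ : 0 < δ) (hφ : M⁻¹.trace < δ⁻¹) :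
    δ⁻¹ - M⁻¹.trace ≤
      ((M - δ • (1 : Matrix ι ι ℝ))⁻¹ * (M - δ • (1 : Matrix ι ι ℝ))⁻¹).trace /
        ((M - δ • (1 : Matrix ι ι ℝ))⁻¹.trace - M⁻¹.trace)
      - (M - δ • (1 : Matrix ι ι ℝ))⁻¹.trace := by
  have gap_pos := sub_pos.2 (trace_inv_lt_trace_inv_sub_smul_one hM hδ hφ)
  obtain ⟨E, l, hE, rfl, hl⟩ := exists_diagonalization_lt_of_trace_inv_lt hM hδ hφ
  have hl0 : ∀ i, l i ≠ 0 := fun i => (hδ.trans (hl i)).ne'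
  have hlδ : ∀ i, l i - δ ≠ 0 := fun i => (sub_pos.2 (hl i)).ne'
  rw [le_sub_iff_add_le, le_div_iff₀ gap_pos, orthogonal_conj_diagonal_sub_smul_one hE,
    trace_inv_mul_inv_orthogonal_conj_diagonal hE hlδ, trace_inv_orthogonal_conj_diagonal hE hlδ]
  rw [trace_inv_orthogonal_conj_diagonal hE hl0] at hφ ⊢
  exact sum_inv_gap_mul_le hδ hl hφ.le

theorem trace_inv_mul_inv_div_add_le (hM : M.PosDef) (hδ : 0 < δ) :
    ((M + δ • (1 : Matrix ι ι ℝ))⁻¹ * (M + δ • (1 : Matrix ι ι ℝ))⁻¹).trace /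
        (M⁻¹.trace - (M + δ • (1 : Matrix ι ι ℝ))⁻¹.trace)
      + (M + δ • (1 : Matrix ι ι ℝ))⁻¹.trace ≤ δ⁻¹ + M⁻¹.trace := by
  obtain ⟨E, l, hE, rfl, hl⟩ := exists_posDef_diagonalization hM
  have hlδ : ∀ i, l i + δ ≠ 0 := fun i => (add_pos (hl i) hδ).ne'
  rw [orthogonal_conj_diagonal_add_smul_one hE,
    trace_inv_mul_inv_orthogonal_conj_diagonal hE hlδ, trace_inv_orthogonal_conj_diagonal hE hlδ,
    trace_inv_orthogonal_conj_diagonal hE fun i => (hl i).ne']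
  have trace_le : ∑ i, (l i + δ)⁻¹ ≤ ∑ i, (l i)⁻¹ :=
    Finset.sum_le_sum fun i _ => inv_anti₀ (hl i) (le_add_of_nonneg_right hδ.le)
  gcongr
  exact div_le_of_le_mul₀ (sub_nonneg.2 trace_le) (inv_pos.2 hδ).le
    (sum_inv_add_mul_inv_add_le hδ hl)

end Shift

/-! ### Rank-one updates -/

section RankOne

open Matrix

variable {ι K : Type*} [Fintype ι] [DecidableEq ι] [Field K] {A : Matrix ι ι K}

theorem isUnit_add_vecMulVec_iff (hA : IsUnit A) (u v : ι → K) :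
    IsUnit (A + vecMulVec u v) ↔ 1 + v ⬝ᵥ (A⁻¹ *ᵥ u) ≠ 0 := by
  have hdet := (isUnit_iff_isUnit_det A).1 hA
  rw [isUnit_iff_isUnit_det, vecMulVec_eq Unit, det_add_replicateCol_mul_replicateRow hdet,
    IsUnit.mul_iff, and_iff_right hdet, isUnit_iff_ne_zero, det_unique, Matrix.mul_assoc,
    ← replicateCol_mulVec, Matrix.add_apply, one_apply_eq, replicateRow_mul_replicateCol_apply]

theorem inv_add_vecMulVec (hA : IsUnit A) {u v : ι → K} (h : 1 + v ⬝ᵥ (A⁻¹ *ᵥ u) ≠ 0) :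
    (A + vecMulVec u v)⁻¹
      = A⁻¹ - (1 + v ⬝ᵥ (A⁻¹ *ᵥ u))⁻¹ • vecMulVec (A⁻¹ *ᵥ u) (v ᵥ* A⁻¹) := by
  have hdet := (isUnit_iff_isUnit_det A).1 hA
  refine Matrix.inv_eq_right_inv ?_
  set q := v ⬝ᵥ (A⁻¹ *ᵥ u)
  have hA_mul : A * vecMulVec (A⁻¹ *ᵥ u) (v ᵥ* A⁻¹) = vecMulVec u (v ᵥ* A⁻¹) := by
    rw [mul_vecMulVec, mulVec_mulVec, mul_nonsing_inv _ hdet, one_mulVec]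
  have huv_mul : vecMulVec u v * vecMulVec (A⁻¹ *ᵥ u) (v ᵥ* A⁻¹)
      = q • vecMulVec u (v ᵥ* A⁻¹) := by
    rw [vecMulVec_mul_vecMulVec, vecMulVec_smul]
  rw [Matrix.mul_sub, Matrix.add_mul, mul_nonsing_inv _ hdet, vecMulVec_mul, Matrix.mul_smul,
    Matrix.add_mul, hA_mul, huv_mul]
  match_scalars
  · ring
  · field_simp; ring

theorem trace_inv_add_smul_vecMulVec (hA : IsUnit A) {u v : ι → K} {t : K}
    (h : 1 + t * (v ⬝ᵥ (A⁻¹ *ᵥ u)) ≠ 0) :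
    (A + t • vecMulVec u v)⁻¹.trace
      = A⁻¹.trace - t * (v ⬝ᵥ ((A⁻¹ * A⁻¹) *ᵥ u)) / (1 + t * (v ⬝ᵥ (A⁻¹ *ᵥ u))) := by
  have form_smul (N : Matrix ι ι K) : v ⬝ᵥ (N *ᵥ (t • u)) = t * (v ⬝ᵥ (N *ᵥ u)) := by
    rw [mulVec_smul, dotProduct_smul, smul_eq_mul]
  rw [← form_smul] at h
  rw [← smul_vecMulVec, inv_add_vecMulVec hA h, trace_sub, trace_smul, trace_vecMulVec,
    dotProduct_comm _ (v ᵥ* A⁻¹), ← dotProduct_mulVec, mulVec_mulVec, smul_eq_mul, ← div_eq_inv_mul,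
    form_smul, form_smul]

end RankOne

section RankOnePosDef

open Matrix

theorem dotProduct_sq_le {κ : Type*} [Fintype κ] (x y : κ → ℝ) :
    (x ⬝ᵥ y) ^ 2 ≤ (x ⬝ᵥ x) * (y ⬝ᵥ y) := by
  simpa only [dotProduct, sq] using Finset.sum_mul_sq_le_sq_mul_sq Finset.univ x y

variable {ι : Type*} [Fintype ι] [DecidableEq ι] {M : Matrix ι ι ℝ}

theorem dotProduct_inv_mulVec_nonneg (hM : M.PosDef) (v : ι → ℝ) : 0 ≤ v ⬝ᵥ (M⁻¹ *ᵥ v) := by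
  simpa using hM.inv.posSemidef.dotProduct_mulVec_nonneg v

theorem dotProduct_inv_mul_inv_mulVec_pos (hM : M.PosDef) {v : ι → ℝ} (hv : v ≠ 0) :
    0 < v ⬝ᵥ ((M⁻¹ * M⁻¹) *ᵥ v) := by
  have hsq := PosDef.conjTranspose_mul_self M⁻¹ (mulVec_injective_of_isUnit hM.inv.isUnit)
  rw [hM.inv.1.eq] at hsq
  simpa using hsq.dotProduct_mulVec_pos hv

open scoped MatrixOrder Matrix.Norms.L2Operator in
theorem dotProduct_sq_le_of_posDef (hM : M.PosDef) (v x : ι → ℝ) :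
    (v ⬝ᵥ x) ^ 2 ≤ (v ⬝ᵥ (M⁻¹ *ᵥ v)) * (x ⬝ᵥ (M *ᵥ x)) := by
  obtain ⟨B, hB⟩ := CStarAlgebra.nonneg_iff_eq_star_mul_self.1 hM.posSemidef.nonneg
  have hMy : ∀ y z : ι → ℝ, y ⬝ᵥ (M *ᵥ z) = (B *ᵥ y) ⬝ᵥ (B *ᵥ z) := fun y z => by
    rw [hB, star_eq_conjTranspose, conjTranspose_eq_transpose_of_trivial, ← mulVec_mulVec,
      dotProduct_mulVec, vecMul_transpose]
  have hv : v = M *ᵥ (M⁻¹ *ᵥ v) := by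
    rw [mulVec_mulVec, mul_nonsing_inv _ ((isUnit_iff_isUnit_det M).1 hM.isUnit), one_mulVec]
  have hvx : v ⬝ᵥ x = (B *ᵥ x) ⬝ᵥ (B *ᵥ (M⁻¹ *ᵥ v)) := by
    rw [← hMy, ← hv, dotProduct_comm]
  have hvv : v ⬝ᵥ (M⁻¹ *ᵥ v) = (B *ᵥ (M⁻¹ *ᵥ v)) ⬝ᵥ (B *ᵥ (M⁻¹ *ᵥ v)) := by
    rw [← hMy, ← hv, dotProduct_comm]
  rw [hvx, hvv, hMy, mul_comm]
  exact dotProduct_sq_le _ _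

theorem posDef_sub_smul_vecMulVec_self (hM : M.PosDef) (v : ι → ℝ) {t : ℝ} (ht : 0 ≤ t)
    (htv : t * (v ⬝ᵥ (M⁻¹ *ᵥ v)) < 1) : (M - t • vecMulVec v v).PosDef := by
  refine PosDef.of_dotProduct_mulVec_pos (hM.1.sub ?_) fun x hx => ?_
  · ext i j
    simp [vecMulVec_apply, mul_comm]
  have hform : star x ⬝ᵥ ((M - t • vecMulVec v v) *ᵥ x) = x ⬝ᵥ (M *ᵥ x) - t * (v ⬝ᵥ x) ^ 2 := by
    simp only [star_trivial, sub_mulVec, dotProduct_sub, smul_mulVec, vecMulVec_mulVec,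
      dotProduct_smul, op_smul_eq_smul, smul_eq_mul, dotProduct_comm x v]
    ring
  have hxM : 0 < x ⬝ᵥ (M *ᵥ x) := by simpa using hM.dotProduct_mulVec_pos hx
  rw [hform, sub_pos]
  calc
    t * (v ⬝ᵥ x) ^ 2 ≤ t * ((v ⬝ᵥ (M⁻¹ *ᵥ v)) * (x ⬝ᵥ (M *ᵥ x))) := by
      gcongr; exact dotProduct_sq_le_of_posDef hM v x
    _ = t * (v ⬝ᵥ (M⁻¹ *ᵥ v)) * (x ⬝ᵥ (M *ᵥ x)) := (mul_assoc _ _ _).symm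
    _ < x ⬝ᵥ (M *ᵥ x) := mul_lt_of_lt_one_left hxM htv

end RankOnePosDef

/-! ### The two barriers -/

namespace DualSet

open Matrix

theorem sum_dotProduct_mulVec_row {m n : ℕ} {V : Matrix (Fin m) (Fin n) ℝ} (hV : Vᵀ * V = 1)
    (N : Matrix (Fin n) (Fin n) ℝ) : ∑ j, V j ⬝ᵥ (N *ᵥ V j) = N.trace := by
  change (V * (N * Vᵀ)).trace = N.trace
  rw [Matrix.trace_mul_comm, Matrix.mul_assoc, hV, Matrix.mul_one]

section Lower

variable {n : ℕ} {A : Matrix (Fin n) (Fin n) ℝ} {L δ t : ℝ}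

theorem posDef_sub_add_smul_one (hA : (A - L • (1 : Matrix (Fin n) (Fin n) ℝ)).PosDef)
    (hδ : 0 < δ) (hφ : lowerPotential L A < δ⁻¹) :
    (A - (L + δ) • (1 : Matrix (Fin n) (Fin n) ℝ)).PosDef := by
  rw [add_smul, ← sub_sub]
  exact posDef_sub_smul_one_of_trace_inv_lt hA hδ hφ

theorem posDef_lower_update (hA : (A - L • (1 : Matrix (Fin n) (Fin n) ℝ)).PosDef) (hδ : 0 < δ)
    (hφ : lowerPotential L A < δ⁻¹) (v : Fin n → ℝ) (ht : 0 ≤ t) :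
    (A + t • vecMulVec v v - (L + δ) • (1 : Matrix (Fin n) (Fin n) ℝ)).PosDef := by
  rw [add_sub_right_comm]
  refine (posDef_sub_add_smul_one hA hδ hφ).add_posSemidef (PosSemidef.smul ?_ ht)
  simpa using posSemidef_vecMulVec_self_star v

variable [Nonempty (Fin n)]

theorem inv_sub_lowerPotential_le_sum_lowerGain {m : ℕ} {V : Matrix (Fin m) (Fin n) ℝ}
    (hV : Vᵀ * V = 1) (hA : (A - L • (1 : Matrix (Fin n) (Fin n) ℝ)).PosDef) (hδ : 0 < δ)
    (hφ : lowerPotential L A < δ⁻¹) :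
    δ⁻¹ - lowerPotential L A ≤ ∑ j, lowerGain (V j) δ A L := by
  simp only [lowerGain]
  rw [Finset.sum_sub_distrib, ← Finset.sum_div, sum_dotProduct_mulVec_row hV,
    sum_dotProduct_mulVec_row hV]
  simpa only [lowerPotential, add_smul, sub_sub] using inv_sub_trace_inv_le hA hδ hφ

theorem lowerPotential_lt_add (hA : (A - L • (1 : Matrix (Fin n) (Fin n) ℝ)).PosDef)
    (hδ : 0 < δ) (hφ : lowerPotential L A < δ⁻¹) :
    lowerPotential L A < lowerPotential (L + δ) A := by
  simpa only [lowerPotential, add_smul, sub_sub] using trace_inv_lt_trace_inv_sub_smul_one hA hδ hφ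

theorem lowerPotential_update_le (hA : (A - L • (1 : Matrix (Fin n) (Fin n) ℝ)).PosDef)
    (hδ : 0 < δ) (hφ : lowerPotential L A < δ⁻¹) {v : Fin n → ℝ} (ht : 0 < t)
    (htv : t⁻¹ ≤ lowerGain v δ A L) :
    lowerPotential (L + δ) (A + t • vecMulVec v v) ≤ lowerPotential L A := by
  have gap_pos := sub_pos.2 (lowerPotential_lt_add hA hδ hφ)
  have hM := posDef_sub_add_smul_one hA hδ hφ
  simp only [lowerGain] at htv
  set M := A - (L + δ) • (1 : Matrix (Fin n) (Fin n) ℝ)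
  have hpos : 0 < 1 + t * (v ⬝ᵥ (M⁻¹ *ᵥ v)) := by
    have := dotProduct_inv_mulVec_nonneg hM v
    positivity
  rw [lowerPotential, add_sub_right_comm, trace_inv_add_smul_vecMulVec hM.isUnit hpos.ne',
    sub_le_comm, le_div_iff₀ hpos]
  rw [le_sub_iff_add_le, le_div_iff₀ gap_pos] at htv
  calc
    _ = t * ((t⁻¹ + v ⬝ᵥ (M⁻¹ *ᵥ v)) * (lowerPotential (L + δ) A - lowerPotential L A)) := by
      field_simp; rfl
    _ ≤ _ := by gcongr

end Lower

section Upper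

variable {l : ℕ} {B : Matrix (Fin l) (Fin l) ℝ} {T δ t : ℝ}

theorem posDef_add_smul_one_sub (hB : (T • (1 : Matrix (Fin l) (Fin l) ℝ) - B).PosDef)
    (hδ : 0 < δ) : ((T + δ) • (1 : Matrix (Fin l) (Fin l) ℝ) - B).PosDef := by
  rw [add_smul, add_sub_right_comm]
  exact hB.add (PosDef.one.smul hδ)

theorem sum_upperGain_le {m : ℕ} {U : Matrix (Fin m) (Fin l) ℝ} (hU : Uᵀ * U = 1)
    (hB : (T • (1 : Matrix (Fin l) (Fin l) ℝ) - B).PosDef) (hδ : 0 < δ) :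
    ∑ j, upperGain (U j) δ B T ≤ δ⁻¹ + upperPotential T B := by
  simp only [upperGain]
  rw [Finset.sum_add_distrib, ← Finset.sum_div, sum_dotProduct_mulVec_row hU,
    sum_dotProduct_mulVec_row hU]
  simpa only [upperPotential, add_smul, add_sub_right_comm] using
    trace_inv_mul_inv_div_add_le hB hδ

variable [Nonempty (Fin l)] {u : Fin l → ℝ}

theorem upperPotential_add_lt (hB : (T • (1 : Matrix (Fin l) (Fin l) ℝ) - B).PosDef)
    (hδ : 0 < δ) : upperPotential (T + δ) B < upperPotential T B := by
  simpa only [upperPotential, add_smul, add_sub_right_comm] using trace_inv_add_smul_one_lt hB hδ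

theorem dotProduct_inv_mulVec_lt_upperGain (hB : (T • (1 : Matrix (Fin l) (Fin l) ℝ) - B).PosDef)
    (hδ : 0 < δ) (hu : u ≠ 0) :
    u ⬝ᵥ (((T + δ) • (1 : Matrix (Fin l) (Fin l) ℝ) - B)⁻¹ *ᵥ u) < upperGain u δ B T :=
  lt_add_of_pos_left _ <| div_pos
    (dotProduct_inv_mul_inv_mulVec_pos (posDef_add_smul_one_sub hB hδ) hu)
    (sub_pos.2 (upperPotential_add_lt hB hδ))

theorem upperGain_pos (hB : (T • (1 : Matrix (Fin l) (Fin l) ℝ) - B).PosDef) (hδ : 0 < δ)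
    (hu : u ≠ 0) : 0 < upperGain u δ B T :=
  (dotProduct_inv_mulVec_nonneg (posDef_add_smul_one_sub hB hδ) u).trans_lt
    (dotProduct_inv_mulVec_lt_upperGain hB hδ hu)

theorem mul_dotProduct_inv_mulVec_lt_one (hB : (T • (1 : Matrix (Fin l) (Fin l) ℝ) - B).PosDef)
    (hδ : 0 < δ) (hu : u ≠ 0) (ht : 0 < t) (htu : upperGain u δ B T ≤ t⁻¹) :
    t * (u ⬝ᵥ (((T + δ) • (1 : Matrix (Fin l) (Fin l) ℝ) - B)⁻¹ *ᵥ u)) < 1 :=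
  (lt_inv_mul_iff₀ ht).1 <| by
    simpa using (dotProduct_inv_mulVec_lt_upperGain hB hδ hu).trans_le htu

theorem posDef_upper_update (hB : (T • (1 : Matrix (Fin l) (Fin l) ℝ) - B).PosDef) (hδ : 0 < δ)
    (hu : u ≠ 0) (ht : 0 < t) (htu : upperGain u δ B T ≤ t⁻¹) :
    ((T + δ) • (1 : Matrix (Fin l) (Fin l) ℝ) - (B + t • vecMulVec u u)).PosDef := by
  rw [← sub_sub]
  exact posDef_sub_smul_vecMulVec_self (posDef_add_smul_one_sub hB hδ) u ht.le
    (mul_dotProduct_inv_mulVec_lt_one hB hδ hu ht htu)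

theorem upperPotential_update_le (hB : (T • (1 : Matrix (Fin l) (Fin l) ℝ) - B).PosDef)
    (hδ : 0 < δ) (hu : u ≠ 0) (ht : 0 < t) (htu : upperGain u δ B T ≤ t⁻¹) :
    upperPotential (T + δ) (B + t • vecMulVec u u) ≤ upperPotential T B := by
  have hlt := mul_dotProduct_inv_mulVec_lt_one hB hδ hu ht htu
  have gap_pos := sub_pos.2 (upperPotential_add_lt hB hδ)
  have hM := posDef_add_smul_one_sub hB hδ
  simp only [upperGain] at htu
  set M := (T + δ) • (1 : Matrix (Fin l) (Fin l) ℝ) - B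
  have hpos : 0 < 1 + -t * (u ⬝ᵥ (M⁻¹ *ᵥ u)) := by linarith
  rw [upperPotential, ← sub_sub, sub_eq_add_neg, ← neg_smul,
    trace_inv_add_smul_vecMulVec hM.isUnit hpos.ne', neg_mul, neg_div, sub_neg_eq_add,
    ← le_sub_iff_add_le', div_le_iff₀ hpos]
  rw [← le_sub_iff_add_le, div_le_iff₀ gap_pos] at htu
  calc
    _ ≤ t * ((t⁻¹ - u ⬝ᵥ (M⁻¹ *ᵥ u)) * (upperPotential T B - upperPotential (T + δ) B)) := by
      gcongr
    _ = (upperPotential T B - upperPotential (T + δ) B) * (1 + -t * (u ⬝ᵥ (M⁻¹ *ᵥ u))) := by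
      field_simp; ring

end Upper

end DualSet

/-! ### Dual set spectral sparsification -/

namespace DualSet

open Matrix

variable {m n l k : ℕ}

section Levels

/-- The position of the lower barrier before iteration `τ`. -/
noncomputable def lowerLevel (n k τ : ℕ) : ℝ :=
  τ - √((n : ℝ) * k)

/-- The position of the upper barrier before iteration `τ`. -/
noncomputable def upperLevel (n l k τ : ℕ) : ℝ :=
  upperStep n l k * (τ + √((l : ℝ) * k))

theorem lowerLevel_succ (n k τ : ℕ) : lowerLevel n k (τ + 1) = lowerLevel n k τ + 1 := by
  simp only [lowerLevel, Nat.cast_add_one]; ring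

theorem upperLevel_succ (n l k τ : ℕ) :
    upperLevel n l k (τ + 1) = upperLevel n l k τ + upperStep n l k := by
  simp only [upperLevel, Nat.cast_add_one]; ring

theorem sqrt_div_lt_one (hk : n < k) : √((n : ℝ) / k) < 1 := by
  have hk0 : (0 : ℝ) < k := by exact_mod_cast (Nat.zero_le n).trans_lt hk
  rw [Real.sqrt_lt' one_pos, one_pow, div_lt_one hk0]
  exact_mod_cast hk

theorem sqrt_mul_eq_mul_sqrt_div (a k : ℕ) : √((a : ℝ) * k) = k * √((a : ℝ) / k) := by
  rcases eq_or_ne k 0 with rfl | hk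
  · simp
  · have hk0 : (k : ℝ) ≠ 0 := by exact_mod_cast hk
    rw [← Real.sqrt_sq k.cast_nonneg, ← Real.sqrt_mul (sq_nonneg _), Real.sqrt_sq k.cast_nonneg]
    congr 1
    field_simp

theorem mul_inv_sqrt_mul (a k : ℕ) : (a : ℝ) * (√((a : ℝ) * k))⁻¹ = √((a : ℝ) / k) := by
  rw [Real.sqrt_mul a.cast_nonneg, Real.sqrt_div a.cast_nonneg, mul_inv, ← mul_assoc,
    ← div_eq_mul_inv (a : ℝ), Real.div_sqrt, div_eq_mul_inv]

theorem upperStep_pos (l : ℕ) (hk : n < k) : 0 < upperStep n l k :=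
  div_pos (by positivity) (sub_pos.2 (sqrt_div_lt_one hk))

theorem inv_upperStep_add (l : ℕ) (hk : n < k) :
    (upperStep n l k)⁻¹ + √((l : ℝ) / k) / upperStep n l k = 1 - √((n : ℝ) / k) := by
  have : 0 < 1 - √((n : ℝ) / k) := sub_pos.2 (sqrt_div_lt_one hk)
  have : (0 : ℝ) < 1 + √((l : ℝ) / k) := by positivity
  rw [upperStep]
  field_simp

theorem lowerLevel_self (n k : ℕ) : lowerLevel n k k = k * (1 - √((n : ℝ) / k)) := by
  rw [lowerLevel, sqrt_mul_eq_mul_sqrt_div]; ring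

theorem upperLevel_self (n l k : ℕ) :
    upperLevel n l k k = upperStep n l k * (k * (1 + √((l : ℝ) / k))) := by
  rw [upperLevel, sqrt_mul_eq_mul_sqrt_div]; ring

end Levels

theorem trace_inv_smul_one {c : ℝ} (hc : c ≠ 0) (n : ℕ) :
    (c • (1 : Matrix (Fin n) (Fin n) ℝ))⁻¹.trace = n * c⁻¹ := by
  have h : (c • (1 : Matrix (Fin n) (Fin n) ℝ))⁻¹ = c⁻¹ • 1 :=
    Matrix.inv_eq_right_inv (by simp [smul_smul, hc])
  rw [h, trace_smul, trace_one, Fintype.card_fin, smul_eq_mul, mul_comm]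

theorem transpose_mul_diagonal_add_single_mul (W : Matrix (Fin m) (Fin n) ℝ) (s : Fin m → ℝ)
    (j : Fin m) (t : ℝ) :
    Wᵀ * diagonal (s + Pi.single j t) * W = Wᵀ * diagonal s * W + t • vecMulVec (W j) (W j) := by
  have h : Wᵀ * diagonal (Pi.single j t) * W = t • vecMulVec (W j) (W j) := by
    ext a b
    rw [Matrix.mul_apply, Finset.sum_eq_single j]
    · simp [mul_diagonal, vecMulVec_apply]; ring
    · intro i _ hi; simp [mul_diagonal, hi]
    · simp
  rw [← h, ← Matrix.add_mul, ← Matrix.mul_add, diagonal_add]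
  rfl

theorem dotProduct_transpose_mul_diagonal_mul_mulVec (W : Matrix (Fin m) (Fin n) ℝ)
    (s : Fin m → ℝ) (z : Fin n → ℝ) :
    z ⬝ᵥ ((Wᵀ * diagonal s * W) *ᵥ z) = ∑ i, s i * (W *ᵥ z) i ^ 2 := by
  rw [← mulVec_mulVec, ← mulVec_mulVec, dotProduct_mulVec, vecMul_transpose]
  refine Finset.sum_congr rfl fun i _ => ?_
  rw [mulVec_diagonal]; ring

theorem card_support_add_single_le (s : Fin m → ℝ) (j : Fin m) (t : ℝ) :
    (Finset.univ.filter fun i => (s + Pi.single j t : Fin m → ℝ) i ≠ 0).card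
      ≤ (Finset.univ.filter fun i => s i ≠ 0).card + 1 := by
  refine (Finset.card_le_card fun i hi => ?_).trans
    (Finset.card_insert_le j (Finset.univ.filter fun i => s i ≠ 0))
  rcases eq_or_ne i j with rfl | hij
  · exact Finset.mem_insert_self _ _
  · simpa [hij] using hi

/-- The barrier conditions satisfied before iteration `τ`: the barriers `L` and `T` satisfy
`L I < A = ∑ sᵢ vᵢ vᵢᵀ` and `B = ∑ sᵢ uᵢ uᵢᵀ < T I`, where `vᵢ` and `uᵢ` are the rows of `V` and
`U`, and both potentials are at most their initial values. -/
structure BarrierInvariant (V : Matrix (Fin m) (Fin n) ℝ) (U : Matrix (Fin m) (Fin l) ℝ) (k τ : ℕ)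
    (st : State m n l) : Prop where
  A_eq : st.A = Vᵀ * diagonal st.s * V
  B_eq : st.B = Uᵀ * diagonal st.s * U
  card_support_le : (Finset.univ.filter fun i => st.s i ≠ 0).card ≤ τ
  lower_posDef : (st.A - lowerLevel n k τ • (1 : Matrix (Fin n) (Fin n) ℝ)).PosDef
  lowerPotential_le : lowerPotential (lowerLevel n k τ) st.A ≤ √((n : ℝ) / k)
  upper_posDef : (upperLevel n l k τ • (1 : Matrix (Fin l) (Fin l) ℝ) - st.B).PosDef
  upperPotential_le :
    upperPotential (upperLevel n l k τ) st.B ≤ √((l : ℝ) / k) / upperStep n l k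

namespace BarrierInvariant

variable {V : Matrix (Fin m) (Fin n) ℝ} {U : Matrix (Fin m) (Fin l) ℝ} {τ : ℕ}
  {st st' : State m n l}

theorem zero (hn : 0 < n) (hk : n < k) (hl : 0 < l) :
    BarrierInvariant V U k 0 { s := 0, A := 0, B := 0 } := by
  have : (0 : ℝ) < n := by exact_mod_cast hn
  have : (0 : ℝ) < l := by exact_mod_cast hl
  have : (0 : ℝ) < k := by exact_mod_cast hn.trans hk
  have hδ := upperStep_pos l hk
  have hL : -lowerLevel n k 0 = √((n : ℝ) * k) := by simp [lowerLevel]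
  have hT : upperLevel n l k 0 = upperStep n l k * √((l : ℝ) * k) := by simp [upperLevel]
  have hT0 : 0 < upperLevel n l k 0 := by rw [hT]; positivity
  refine ⟨by simp, by simp, by simp, ?_, ?_, ?_, ?_⟩
  · rw [zero_sub, ← neg_smul, hL]
    exact PosDef.one.smul (by positivity)
  · rw [lowerPotential, zero_sub, ← neg_smul, hL, trace_inv_smul_one (by positivity),
      mul_inv_sqrt_mul]
  · rw [sub_zero]
    exact PosDef.one.smul hT0
  · rw [upperPotential, sub_zero, trace_inv_smul_one hT0.ne', hT, mul_inv, mul_left_comm,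
      mul_inv_sqrt_mul, inv_mul_eq_div]

theorem lowerPotential_lt_inv_one (h : BarrierInvariant V U k τ st) (hk : n < k) :
    lowerPotential (lowerLevel n k τ) st.A < 1⁻¹ := by
  rw [inv_one]
  exact h.lowerPotential_le.trans_lt (sqrt_div_lt_one hk)

theorem exists_upperGain_le_lowerGain (h : BarrierInvariant V U k τ st) (hn : 0 < n) (hk : n < k)
    (hV : Vᵀ * V = 1) (hU : Uᵀ * U = 1) :
    ∃ j, upperGain (U j) (upperStep n l k) st.B (upperLevel n l k τ)
      ≤ lowerGain (V j) 1 st.A (lowerLevel n k τ) := by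
  have : Nonempty (Fin n) := Fin.pos_iff_nonempty.1 hn
  have sum_upper := sum_upperGain_le hU h.upper_posDef (upperStep_pos l hk)
  have sum_lower := inv_sub_lowerPotential_le_sum_lowerGain hV h.lower_posDef one_pos
    (h.lowerPotential_lt_inv_one hk)
  have sum_le : ∑ j, upperGain (U j) (upperStep n l k) st.B (upperLevel n l k τ)
      ≤ ∑ j, lowerGain (V j) 1 st.A (lowerLevel n k τ) := by
    rw [inv_one] at sum_lower
    linarith [inv_upperStep_add l hk, h.lowerPotential_le, h.upperPotential_le]
  have : Nonempty (Fin m) := by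
    by_contra hm
    rw [not_nonempty_iff] at hm
    exact one_ne_zero (hV.symm.trans (by ext; simp [Matrix.mul_apply]))
  obtain ⟨j, -, hj⟩ := Finset.exists_le_of_sum_le Finset.univ_nonempty sum_le
  exact ⟨j, hj⟩

theorem step (h : BarrierInvariant V U k τ st) (hn : 0 < n) (hk : n < k) (hU : ∀ j, U j ≠ 0)
    (hst : IsStep V U k τ st st') : BarrierInvariant V U k (τ + 1) st' := by
  obtain ⟨j, hj, rfl⟩ := hst
  have : Nonempty (Fin n) := Fin.pos_iff_nonempty.1 hn
  have : Nonempty (Fin l) := (Function.ne_iff.1 (hU j)).nonempty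
  have hδ := upperStep_pos l hk
  have hφ := h.lowerPotential_lt_inv_one hk
  have up_pos := upperGain_pos h.upper_posDef hδ (hU j)
  change upperGain (U j) _ st.B (upperLevel n l k τ) ≤ lowerGain (V j) 1 st.A (lowerLevel n k τ)
    at hj
  set up := upperGain (U j) (upperStep n l k) st.B (upperLevel n l k τ)
  set lo := lowerGain (V j) 1 st.A (lowerLevel n k τ)
  set t := ((up + lo) / 2)⁻¹ with ht
  have t_pos : 0 < t := inv_pos.2 (by linarith)
  have up_le : up ≤ t⁻¹ := by rw [ht, inv_inv]; linarith
  have le_lo : t⁻¹ ≤ lo := by rw [ht, inv_inv]; linarith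
  constructor
  · change st.A + t • vecMulVec (V j) (V j) = Vᵀ * diagonal (st.s + Pi.single j t) * V
    rw [transpose_mul_diagonal_add_single_mul, ← h.A_eq]
  · change st.B + t • vecMulVec (U j) (U j) = Uᵀ * diagonal (st.s + Pi.single j t) * U
    rw [transpose_mul_diagonal_add_single_mul, ← h.B_eq]
  · exact (card_support_add_single_le _ _ _).trans (Nat.succ_le_succ h.card_support_le)
  · rw [lowerLevel_succ]
    exact posDef_lower_update h.lower_posDef one_pos hφ _ t_pos.le
  · rw [lowerLevel_succ]
    exact (lowerPotential_update_le h.lower_posDef one_pos hφ t_pos le_lo).trans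
      h.lowerPotential_le
  · rw [upperLevel_succ]
    exact posDef_upper_update h.upper_posDef hδ (hU j) t_pos up_le
  · rw [upperLevel_succ]
    exact (upperPotential_update_le h.upper_posDef hδ (hU j) t_pos up_le).trans
      h.upperPotential_le

theorem mul_dotProduct_le (h : BarrierInvariant V U k τ st) (z : Fin n → ℝ) :
    lowerLevel n k τ * (z ⬝ᵥ z) ≤ ∑ i, st.s i * (V *ᵥ z) i ^ 2 := by
  have hz := h.lower_posDef.posSemidef.dotProduct_mulVec_nonneg z
  rwa [sub_mulVec, dotProduct_sub, star_trivial, smul_mulVec, one_mulVec, dotProduct_smul,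
    smul_eq_mul, h.A_eq, dotProduct_transpose_mul_diagonal_mul_mulVec, sub_nonneg] at hz

theorem sum_mul_sq_le (h : BarrierInvariant V U k τ st) (z : Fin l → ℝ) :
    ∑ i, st.s i * (U *ᵥ z) i ^ 2 ≤ upperLevel n l k τ * (z ⬝ᵥ z) := by
  have hz := h.upper_posDef.posSemidef.dotProduct_mulVec_nonneg z
  rwa [sub_mulVec, dotProduct_sub, star_trivial, smul_mulVec, one_mulVec, dotProduct_smul,
    smul_eq_mul, h.B_eq, dotProduct_transpose_mul_diagonal_mul_mulVec, sub_nonneg] at hz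

end BarrierInvariant

/-- `st` is reachable from the zero state by `τ` iterations on the rows of `V` and `U`. -/
def Reachable (V : Matrix (Fin m) (Fin n) ℝ) (U : Matrix (Fin m) (Fin l) ℝ) (k τ : ℕ)
    (st : State m n l) : Prop :=
  ∃ f : ℕ → State m n l, f 0 = { s := 0, A := 0, B := 0 } ∧
    (∀ i < τ, IsStep V U k i (f i) (f (i + 1))) ∧ f τ = st

namespace Reachable

variable {V : Matrix (Fin m) (Fin n) ℝ} {U : Matrix (Fin m) (Fin l) ℝ} {τ : ℕ}
  {st st' : State m n l}

theorem zero : Reachable V U k 0 { s := 0, A := 0, B := 0 } :=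
  ⟨fun _ => { s := 0, A := 0, B := 0 }, rfl, fun i hi => absurd hi (Nat.not_lt_zero i), rfl⟩

theorem succ (h : Reachable V U k τ st) (hst : IsStep V U k τ st st') :
    Reachable V U k (τ + 1) st' := by
  obtain ⟨f, h0, hf, rfl⟩ := h
  refine ⟨Function.update f (τ + 1) st', ?_, fun i hi => ?_, by simp⟩
  · rw [Function.update_of_ne (by omega), h0]
  · rw [Function.update_of_ne (by omega : i ≠ τ + 1)]
    rcases (Nat.lt_succ_iff.1 hi).eq_or_lt with rfl | h
    · rwa [Function.update_self]
    · rw [Function.update_of_ne (by omega)]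
      exact hf i h

theorem barrierInvariant (h : Reachable V U k τ st) (hn : 0 < n) (hk : n < k) (hl : 0 < l)
    (hU : ∀ j, U j ≠ 0) : BarrierInvariant V U k τ st := by
  obtain ⟨f, h0, hf, rfl⟩ := h
  suffices ∀ i ≤ τ, BarrierInvariant V U k i (f i) from this τ le_rfl
  intro i
  induction i with
  | zero => exact fun _ => h0 ▸ .zero hn hk hl
  | succ i ih => exact fun hi => (ih (by omega)).step hn hk hU (hf i hi)

end Reachable

theorem isOutput_iff {V : Matrix (Fin m) (Fin n) ℝ} {U : Matrix (Fin m) (Fin l) ℝ}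
    {s : Fin m → ℝ} :
    IsOutput V U k s ↔ ∃ st, Reachable V U k k st ∧ s = ((1 - √((n : ℝ) / k)) / k) • st.s :=
  ⟨fun ⟨f, h0, hf, hs⟩ => ⟨f k, ⟨f, h0, hf, rfl⟩, hs⟩,
    fun ⟨_, ⟨f, h0, hf, hfk⟩, hs⟩ => ⟨f, h0, hf, hfk ▸ hs⟩⟩

namespace IsOutput

variable {V : Matrix (Fin m) (Fin n) ℝ} {U : Matrix (Fin m) (Fin l) ℝ} {s : Fin m → ℝ}

theorem card_support_le (hs : IsOutput V U k s) (hn : 0 < n) (hk : n < k) (hl : 0 < l)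
    (hU : ∀ j, U j ≠ 0) : (Finset.univ.filter fun i => s i ≠ 0).card ≤ k := by
  obtain ⟨st, hst, rfl⟩ := isOutput_iff.1 hs
  refine (Finset.card_le_card fun i => ?_).trans (hst.barrierInvariant hn hk hl hU).card_support_le
  simp

theorem mul_dotProduct_le (hs : IsOutput V U k s) (hn : 0 < n) (hk : n < k) (hl : 0 < l)
    (hU : ∀ j, U j ≠ 0) (z : Fin n → ℝ) :
    (1 - √((n : ℝ) / k)) ^ 2 * (z ⬝ᵥ z) ≤ ∑ i, s i * (V *ᵥ z) i ^ 2 := by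
  obtain ⟨st, hst, rfl⟩ := isOutput_iff.1 hs
  have hk0 : (0 : ℝ) < k := by exact_mod_cast hn.trans hk
  have ha : 0 < 1 - √((n : ℝ) / k) := sub_pos.2 (sqrt_div_lt_one hk)
  have h := (hst.barrierInvariant hn hk hl hU).mul_dotProduct_le z
  rw [lowerLevel_self] at h
  calc
    _ = (1 - √((n : ℝ) / k)) / k * (k * (1 - √((n : ℝ) / k)) * (z ⬝ᵥ z)) := by field_simp
    _ ≤ (1 - √((n : ℝ) / k)) / k * ∑ i, st.s i * (V *ᵥ z) i ^ 2 := by gcongr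
    _ = _ := by simp only [Finset.mul_sum, Pi.smul_apply, smul_eq_mul, mul_assoc]

theorem sum_mul_sq_le (hs : IsOutput V U k s) (hn : 0 < n) (hk : n < k) (hl : 0 < l)
    (hU : ∀ j, U j ≠ 0) (z : Fin l → ℝ) :
    ∑ i, s i * (U *ᵥ z) i ^ 2 ≤ (1 + √((l : ℝ) / k)) ^ 2 * (z ⬝ᵥ z) := by
  obtain ⟨st, hst, rfl⟩ := isOutput_iff.1 hs
  have hk0 : (0 : ℝ) < k := by exact_mod_cast hn.trans hk
  have ha : 0 < 1 - √((n : ℝ) / k) := sub_pos.2 (sqrt_div_lt_one hk)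
  have h := (hst.barrierInvariant hn hk hl hU).sum_mul_sq_le z
  rw [upperLevel_self, upperStep] at h
  calc
    _ = (1 - √((n : ℝ) / k)) / k * ∑ i, st.s i * (U *ᵥ z) i ^ 2 := by
      simp only [Finset.mul_sum, Pi.smul_apply, smul_eq_mul, mul_assoc]
    _ ≤ (1 - √((n : ℝ) / k)) / k * ((1 + √((l : ℝ) / k)) / (1 - √((n : ℝ) / k))
        * (k * (1 + √((l : ℝ) / k))) * (z ⬝ᵥ z)) := by gcongr
    _ = _ := by field_simp

end IsOutput

end DualSet

/-! ### Pseudo-inverses of matrices of full row rank -/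

section FullRowRank

open Matrix

variable {η ι κ : Type*} [Fintype η] [Fintype ι] [Fintype κ]

theorem posDef_mul_transpose_of_rank_eq {X : Matrix η ι ℝ} (hX : X.rank = Fintype.card η) :
    (X * Xᵀ).PosDef := by
  have h : LinearIndependent ℝ X.row := by
    rw [linearIndependent_iff_card_eq_finrank_span, Set.finrank, ← Matrix.rank_eq_finrank_span_row,
      hX]
  simpa using PosDef.mul_conjTranspose_self X (Matrix.vecMul_injective_iff.2 h)

theorem dotProduct_mul_transpose_mulVec (X : Matrix η ι ℝ) (z : η → ℝ) :
    z ⬝ᵥ ((X * Xᵀ) *ᵥ z) = (Xᵀ *ᵥ z) ⬝ᵥ (Xᵀ *ᵥ z) := by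
  rw [← mulVec_mulVec, dotProduct_mulVec, mulVec_transpose]

variable {X : Matrix η ι ℝ} {Y : Matrix η κ ℝ} {c : ℝ}

theorem posDef_mul_transpose_of_norm_sq_le (hX : (X * Xᵀ).PosDef)
    (hXY : ∀ z, (Xᵀ *ᵥ z) ⬝ᵥ (Xᵀ *ᵥ z) ≤ c * ((Yᵀ *ᵥ z) ⬝ᵥ (Yᵀ *ᵥ z))) :
    (Y * Yᵀ).PosDef := by
  refine PosDef.of_dotProduct_mulVec_pos ?_ fun z hz => ?_
  · simpa using Matrix.isHermitian_mul_conjTranspose_self Y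
  have hXz := hX.dotProduct_mulVec_pos hz
  rw [star_trivial, dotProduct_mul_transpose_mulVec] at hXz ⊢
  have hYz : 0 ≤ (Yᵀ *ᵥ z) ⬝ᵥ (Yᵀ *ᵥ z) := Finset.sum_nonneg fun i _ => mul_self_nonneg _
  refine hYz.lt_of_ne fun hYz => (hXz.trans_le (hXY z)).ne' ?_
  rw [← hYz, mul_zero]

theorem rank_eq_of_posDef_mul_transpose (hX : (X * Xᵀ).PosDef) : X.rank = Fintype.card η := by
  classical
  rw [← Matrix.rank_self_mul_transpose, Matrix.rank_of_isUnit _ hX.isUnit]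

theorem mul_pinv_of_posDef [DecidableEq η] (hX : (X * Xᵀ).PosDef) : X * pinv X = 1 := by
  refine hX.isUnit.mul_left_injective ?_
  change X * pinv X * (X * Xᵀ) = 1 * (X * Xᵀ)
  rw [← Matrix.mul_assoc, (pinv_spec X).mul_mul_self, Matrix.one_mul]

/-- With `p = Y⁺ w = Yᵀ z` and `q = X⁺ w`, both `X q` and `Y p` equal `w`, so that
`‖p‖² = ⟪p, Yᵀ z⟫ = ⟪w, z⟫ = ⟪q, Xᵀ z⟫ ≤ ‖q‖ √c ‖p‖`. -/
theorem pinv_mulVec_norm_sq_le (hX : (X * Xᵀ).PosDef)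
    (hXY : ∀ z, (Xᵀ *ᵥ z) ⬝ᵥ (Xᵀ *ᵥ z) ≤ c * ((Yᵀ *ᵥ z) ⬝ᵥ (Yᵀ *ᵥ z))) (w : η → ℝ) :
    (pinv Y *ᵥ w) ⬝ᵥ (pinv Y *ᵥ w) ≤ c * ((pinv X *ᵥ w) ⬝ᵥ (pinv X *ᵥ w)) := by
  classical
  have hY := posDef_mul_transpose_of_norm_sq_le hX hXY
  set p := pinv Y *ᵥ w with hp
  set q := pinv X *ᵥ w with hq
  set z := (pinv Y)ᵀ *ᵥ p with hz
  have hYp : Y *ᵥ p = w := by rw [hp, mulVec_mulVec, mul_pinv_of_posDef hY, one_mulVec]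
  have hXq : X *ᵥ q = w := by rw [hq, mulVec_mulVec, mul_pinv_of_posDef hX, one_mulVec]
  have hpz : p = Yᵀ *ᵥ z := by
    rw [hz, mulVec_mulVec, ← transpose_mul, (pinv_spec Y).symm_right, hp, mulVec_mulVec,
      (pinv_spec Y).mul_mul_inv]
  have hpq : p ⬝ᵥ p = q ⬝ᵥ (Xᵀ *ᵥ z) :=
    calc
      p ⬝ᵥ p = p ⬝ᵥ (Yᵀ *ᵥ z) := congrArg _ hpz
      _ = (Y *ᵥ p) ⬝ᵥ z := by rw [dotProduct_mulVec, vecMul_transpose]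
      _ = (X *ᵥ q) ⬝ᵥ z := by rw [hYp, hXq]
      _ = q ⬝ᵥ (Xᵀ *ᵥ z) := by rw [dotProduct_mulVec q, vecMul_transpose]
  have hq0 : 0 ≤ q ⬝ᵥ q := Finset.sum_nonneg fun i _ => mul_self_nonneg _
  have hp0 : 0 ≤ p ⬝ᵥ p := Finset.sum_nonneg fun i _ => mul_self_nonneg _
  have hXz : (Xᵀ *ᵥ z) ⬝ᵥ (Xᵀ *ᵥ z) ≤ c * (p ⬝ᵥ p) := (hXY z).trans_eq (by rw [← hpz])
  have sq_le : (p ⬝ᵥ p) ^ 2 ≤ (q ⬝ᵥ q) * (c * (p ⬝ᵥ p)) :=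
    calc
      _ ≤ (q ⬝ᵥ q) * ((Xᵀ *ᵥ z) ⬝ᵥ (Xᵀ *ᵥ z)) := hpq ▸ dotProduct_sq_le _ _
      _ ≤ _ := by gcongr
  rcases hp0.eq_or_lt with hp0 | hp0
  · have hw : w = 0 := by rw [← hYp, dotProduct_self_eq_zero.1 hp0.symm, mulVec_zero]
    have hq_zero : q = 0 := by rw [hq, hw, mulVec_zero]
    rw [← hp0, hq_zero, dotProduct_zero, mul_zero]
  · exact le_of_mul_le_mul_right (by linarith) hp0

end FullRowRank

section Norms

open Matrix

variable {η ι κ : Type*} [Fintype η] [Fintype ι] [Fintype κ]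

theorem norm_toEuclideanLin_sq [DecidableEq ι] (A : Matrix κ ι ℝ) (w : EuclideanSpace ℝ ι) :
    ‖(Matrix.toEuclideanLin A).toContinuousLinearMap w‖ ^ 2
      = (A *ᵥ w.ofLp) ⬝ᵥ (A *ᵥ w.ofLp) := by
  rw [EuclideanSpace.norm_sq_eq]
  simp [dotProduct, sq, Matrix.toLpLin_apply]

variable {P : Matrix κ η ℝ} {Q : Matrix ι η ℝ} {c : ℝ}

theorem spectralNorm₂_sq_le (hc : 0 ≤ c)
    (h : ∀ w, (P *ᵥ w) ⬝ᵥ (P *ᵥ w) ≤ c * ((Q *ᵥ w) ⬝ᵥ (Q *ᵥ w))) :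
    spectralNorm₂ P ^ 2 ≤ c * spectralNorm₂ Q ^ 2 := by
  let := Classical.decEq η
  have norm_le : spectralNorm₂ P ≤ √c * spectralNorm₂ Q := by
    refine ContinuousLinearMap.opNorm_le_bound _ (mul_nonneg (Real.sqrt_nonneg _)
      (norm_nonneg _)) fun w => ?_
    have hw := h w.ofLp
    rw [← norm_toEuclideanLin_sq, ← norm_toEuclideanLin_sq] at hw
    have hw_sqrt := Real.le_sqrt_of_sq_le hw
    rw [Real.sqrt_mul hc, Real.sqrt_sq (norm_nonneg _)] at hw_sqrt
    rw [mul_assoc]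
    exact hw_sqrt.trans (mul_le_mul_of_nonneg_left (ContinuousLinearMap.le_opNorm _ w)
      (Real.sqrt_nonneg _))
  calc
    _ ≤ (√c * spectralNorm₂ Q) ^ 2 := pow_le_pow_left₀ (norm_nonneg _) norm_le 2
    _ = _ := by rw [mul_pow, Real.sq_sqrt hc]

theorem frobeniusNorm_sq_eq [DecidableEq η] (P : Matrix κ η ℝ) :
    frobeniusNorm P ^ 2 = ∑ j, (P *ᵥ Pi.single j 1) ⬝ᵥ (P *ᵥ Pi.single j 1) := by
  rw [frobeniusNorm, Real.sq_sqrt (by positivity), Finset.sum_comm]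
  simp [dotProduct, sq]

theorem frobeniusNorm_sq_le (h : ∀ w, (P *ᵥ w) ⬝ᵥ (P *ᵥ w) ≤ c * ((Q *ᵥ w) ⬝ᵥ (Q *ᵥ w))) :
    frobeniusNorm P ^ 2 ≤ c * frobeniusNorm Q ^ 2 := by
  classical
  rw [frobeniusNorm_sq_eq, frobeniusNorm_sq_eq, Finset.mul_sum]
  exact Finset.sum_le_sum fun j _ => h _

end Norms

/-! ### Singular value decompositions of matrices of full row rank -/

section SVD

open Matrix

variable {n m : ℕ} {X : Matrix (Fin n) (Fin m) ℝ}

theorem exists_antitone_orthogonal_diagonalization {A : Matrix (Fin n) (Fin n) ℝ}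
    (hA : A.IsHermitian) :
    ∃ (U : Matrix (Fin n) (Fin n) ℝ) (l : Fin n → ℝ),
      Uᵀ * U = 1 ∧ A = U * diagonal l * Uᵀ ∧ Antitone l := by
  obtain ⟨E, l, hE, rfl⟩ := exists_orthogonal_diagonalization hA
  set ρ := Tuple.sort fun i => -l i
  refine ⟨E.submatrix id ρ, l ∘ ρ, ?_, ?_, fun i j hij =>
    neg_le_neg_iff.1 (Tuple.monotone_sort (fun i => -l i) hij)⟩
  · rw [transpose_submatrix, ← submatrix_mul _ _ ρ id ρ Function.bijective_id, hE,
      submatrix_one _ ρ.injective]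
  · rw [← submatrix_diagonal _ _ ρ.injective, transpose_submatrix, submatrix_mul_equiv,
      submatrix_mul_equiv, submatrix_id_id]

theorem exists_isRightSingularMatrix (hX : (X * Xᵀ).PosDef) :
    ∃ V : Matrix (Fin m) (Fin n) ℝ, IsRightSingularMatrix X V := by
  obtain ⟨U, l, hU, hXU, hl_anti⟩ := exists_antitone_orthogonal_diagonalization hX.1
  have hl : ∀ i, 0 < l i := by rwa [hXU, posDef_orthogonal_conj_diagonal_iff hU] at hX
  have hσ : diagonal (fun i => √(l i)) * diagonal (fun i => (√(l i))⁻¹) = 1 := by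
    simp [fun i => (Real.sqrt_pos.2 (hl i)).ne']
  have gram_eq : Uᵀ * (X * Xᵀ) * U = diagonal fun i => √(l i) * √(l i) := by
    simp only [Real.mul_self_sqrt (hl _).le, hXU]
    calc
      _ = (Uᵀ * U) * diagonal l * (Uᵀ * U) := by simp only [Matrix.mul_assoc]
      _ = diagonal l := by rw [hU, Matrix.one_mul, Matrix.mul_one]
  refine ⟨Xᵀ * U * diagonal fun i => (√(l i))⁻¹, U, fun i => √(l i), hU, ?_,
    fun i j hij => Real.sqrt_le_sqrt (hl_anti hij), fun i => Real.sqrt_pos.2 (hl i), ?_⟩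
  · calc
      _ = diagonal (fun i => (√(l i))⁻¹) * (Uᵀ * (X * Xᵀ) * U) * diagonal fun i => (√(l i))⁻¹ := by
        simp only [transpose_mul, diagonal_transpose, transpose_transpose, Matrix.mul_assoc]
      _ = 1 := by
        rw [gram_eq, diagonal_mul_diagonal, diagonal_mul_diagonal]
        simp [fun i => (Real.sqrt_pos.2 (hl i)).ne']
  · calc
      X = U * (diagonal (fun i => √(l i)) * diagonal fun i => (√(l i))⁻¹) * Uᵀ * X := by
        rw [hσ, Matrix.mul_one, mul_eq_one_comm.1 hU, Matrix.one_mul]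
      _ = _ := by
        simp only [transpose_mul, diagonal_transpose, transpose_transpose, Matrix.mul_assoc]

theorem IsRightSingularMatrix.transpose_mul_self {r : ℕ} {V : Matrix (Fin m) (Fin r) ℝ}
    (hV : IsRightSingularMatrix X V) : Vᵀ * V = 1 :=
  hV.choose_spec.choose_spec.right_orthonormal

theorem IsRightSingularMatrix.exists_isUnit_mul_transpose {V : Matrix (Fin m) (Fin n) ℝ}
    (hV : IsRightSingularMatrix X V) : ∃ R : Matrix (Fin n) (Fin n) ℝ, IsUnit R ∧ X = R * Vᵀ := by
  obtain ⟨U, σ, h⟩ := hV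
  refine ⟨U * diagonal σ, ?_, h.eq⟩
  refine IsUnit.mul (IsUnit.of_mul_eq_one_right _ h.left_orthonormal) ?_
  rw [Matrix.isUnit_diagonal, Pi.isUnit_iff]
  exact fun i => (h.pos i).ne'.isUnit

end SVD

/-! ### Guarantees of the greedy selection -/

section Greedy

open Matrix DualSet

variable {n m k : ℕ} {X : Matrix (Fin n) (Fin m) ℝ} {V : Matrix (Fin m) (Fin n) ℝ}
  {S : Finset (Fin m)}

theorem single_one_eq_one : (fun i : Fin m => (Pi.single i 1 : Fin m → ℝ)) = (1 : Matrix _ _ ℝ) :=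
  funext₂ fun _ _ => one_eq_pi_single.symm

theorem isGreedySelection_iff :
    IsGreedySelection V k S ↔
      ∃ s, IsOutput V (1 : Matrix (Fin m) (Fin m) ℝ) k s ∧ ∀ i, i ∈ S ↔ s i ≠ 0 := by
  rw [← single_one_eq_one]; rfl

theorem one_row_ne_zero (j : Fin m) : (1 : Matrix (Fin m) (Fin m) ℝ) j ≠ 0 :=
  Function.ne_iff.2 ⟨j, by simp⟩

theorem isGreedySelection_of_reachable {st : State m n m} (hk : n < k)
    (hst : Reachable V 1 k k st) (hS : ∀ i, i ∈ S ↔ st.s i ≠ 0) : IsGreedySelection V k S := by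
  have hk0 : (0 : ℝ) < k := by exact_mod_cast (Nat.zero_le n).trans_lt hk
  have scale_ne : (1 - √((n : ℝ) / k)) / k ≠ 0 :=
    (div_pos (sub_pos.2 (sqrt_div_lt_one hk)) hk0).ne'
  refine isGreedySelection_iff.2 ⟨_, isOutput_iff.2 ⟨st, hst, rfl⟩, fun i => ?_⟩
  rw [hS, Pi.smul_apply, smul_ne_zero_iff, and_iff_right scale_ne]

theorem IsGreedySelection.card_le (hn : 0 < n) (hk : n < k) (hm : 0 < m)
    (hS : IsGreedySelection V k S) : S.card ≤ k := by
  obtain ⟨s, hs, hSs⟩ := isGreedySelection_iff.1 hS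
  refine (Finset.card_le_card fun i hi => ?_).trans (hs.card_support_le hn hk hm one_row_ne_zero)
  simpa using (hSs i).1 hi

/-- Testing the upper bound on the basis vectors bounds each weight, so that the weighted sum in
the lower bound is at most a multiple of the unweighted sum over `S`. -/
theorem IsGreedySelection.mul_dotProduct_le (hn : 0 < n) (hk : n < k) (hm : 0 < m)
    (hS : IsGreedySelection V k S) (z : Fin n → ℝ) :
    (1 - √((n : ℝ) / k)) ^ 2 * (z ⬝ᵥ z) ≤
      (1 + √((m : ℝ) / k)) ^ 2 * ∑ i ∈ S, (V *ᵥ z) i ^ 2 := by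
  obtain ⟨s, hs, hSs⟩ := isGreedySelection_iff.1 hS
  have weight_le : ∀ i, s i ≤ (1 + √((m : ℝ) / k)) ^ 2 := fun i => by
    simpa [one_apply, Pi.single_apply] using
      hs.sum_mul_sq_le hn hk hm one_row_ne_zero (Pi.single i 1)
  calc
    _ ≤ ∑ i, s i * (V *ᵥ z) i ^ 2 := hs.mul_dotProduct_le hn hk hm one_row_ne_zero z
    _ = ∑ i ∈ S, s i * (V *ᵥ z) i ^ 2 := by
      refine (Finset.sum_subset (Finset.subset_univ S) fun i _ hi => ?_).symm
      rw [not_not.1 (mt (hSs i).2 hi), zero_mul]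
    _ ≤ _ := by
      rw [Finset.mul_sum]
      gcongr with i
      exact weight_le i

theorem IsGreedySelection.norm_sq_le (hn : 0 < n) (hk : n < k) (hm : 0 < m)
    (hV : IsRightSingularMatrix X V) (hS : IsGreedySelection V k S) (z : Fin n → ℝ) :
    (Xᵀ *ᵥ z) ⬝ᵥ (Xᵀ *ᵥ z) ≤ (1 + √((m : ℝ) / k)) ^ 2 * ((1 - √((n : ℝ) / k)) ^ 2)⁻¹ *
      (((colSubmatrix X S)ᵀ *ᵥ z) ⬝ᵥ ((colSubmatrix X S)ᵀ *ᵥ z)) := by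
  obtain ⟨R, -, rfl⟩ := hV.exists_isUnit_mul_transpose
  have norm_eq : ((R * Vᵀ)ᵀ *ᵥ z) ⬝ᵥ ((R * Vᵀ)ᵀ *ᵥ z) = (Rᵀ *ᵥ z) ⬝ᵥ (Rᵀ *ᵥ z) := by
    rw [transpose_mul, transpose_transpose, ← mulVec_mulVec, dotProduct_mulVec,
      ← mulVec_transpose, mulVec_mulVec _ Vᵀ, hV.transpose_mul_self, one_mulVec]
  have sub_norm_eq : ((colSubmatrix (R * Vᵀ) S)ᵀ *ᵥ z) ⬝ᵥ ((colSubmatrix (R * Vᵀ) S)ᵀ *ᵥ z)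
      = ∑ i ∈ S, (V *ᵥ (Rᵀ *ᵥ z)) i ^ 2 := by
    have hVR : V *ᵥ (Rᵀ *ᵥ z) = (R * Vᵀ)ᵀ *ᵥ z := by
      rw [mulVec_mulVec, transpose_mul, transpose_transpose]
    rw [hVR, ← Finset.sum_coe_sort S]
    exact Finset.sum_congr rfl fun i _ => (sq _).symm
  have gap_pos : 0 < (1 - √((n : ℝ) / k)) ^ 2 := pow_pos (sub_pos.2 (sqrt_div_lt_one hk)) 2
  rw [norm_eq, sub_norm_eq, mul_right_comm, ← div_eq_mul_inv, le_div_iff₀' gap_pos]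
  exact hS.mul_dotProduct_le hn hk hm (Rᵀ *ᵥ z)

theorem IsGreedySelection.rank_eq (hn : 0 < n) (hk : n < k) (hm : 0 < m) (hX : (X * Xᵀ).PosDef)
    (hV : IsRightSingularMatrix X V) (hS : IsGreedySelection V k S) :
    (colSubmatrix X S).rank = n := by
  simpa using rank_eq_of_posDef_mul_transpose
    (posDef_mul_transpose_of_norm_sq_le hX (hS.norm_sq_le hn hk hm hV))

theorem IsGreedySelection.spectralNorm₂_pinv_sq_le (hn : 0 < n) (hk : n < k) (hm : 0 < m)
    (hX : (X * Xᵀ).PosDef) (hV : IsRightSingularMatrix X V) (hS : IsGreedySelection V k S) :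
    spectralNorm₂ (pinv (colSubmatrix X S)) ^ 2 ≤
      (1 + √((m : ℝ) / k)) ^ 2 * ((1 - √((n : ℝ) / k)) ^ 2)⁻¹ * spectralNorm₂ (pinv X) ^ 2 :=
  spectralNorm₂_sq_le (by positivity) (pinv_mulVec_norm_sq_le hX (hS.norm_sq_le hn hk hm hV))

theorem IsGreedySelection.frobeniusNorm_pinv_sq_le (hn : 0 < n) (hk : n < k) (hm : 0 < m)
    (hX : (X * Xᵀ).PosDef) (hV : IsRightSingularMatrix X V) (hS : IsGreedySelection V k S) :
    frobeniusNorm (pinv (colSubmatrix X S)) ^ 2 ≤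
      (1 + √((m : ℝ) / k)) ^ 2 * ((1 - √((n : ℝ) / k)) ^ 2)⁻¹ * frobeniusNorm (pinv X) ^ 2 :=
  frobeniusNorm_sq_le (pinv_mulVec_norm_sq_le hX (hS.norm_sq_le hn hk hm hV))

end Greedy

/-! ### Gains without singular vectors -/

namespace DualSet

section LowerGain

open Matrix

variable {n m : ℕ} {V : Matrix (Fin m) (Fin n) ℝ} {R : Matrix (Fin n) (Fin n) ℝ}

/-- `X diag(s - c) Xᵀ`: for `X = R Vᵀ` with orthonormal columns of `V`, this is
`R (Vᵀ diag(s) V - c I) Rᵀ`. -/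
def shiftedGram (X : Matrix (Fin n) (Fin m) ℝ) (s : Fin m → ℝ) (c : ℝ) :
    Matrix (Fin n) (Fin n) ℝ :=
  X * diagonal (fun i => s i - c) * Xᵀ

/-- The matrix whose quadratic form on the columns of `X` gives the lower gains. -/
noncomputable def gainMatrix (X : Matrix (Fin n) (Fin m) ℝ) (s : Fin m → ℝ) (L : ℝ) :
    Matrix (Fin n) (Fin n) ℝ :=
  let N := (shiftedGram X s (L + 1))⁻¹
  ((N - (shiftedGram X s L)⁻¹) * (X * Xᵀ)).trace⁻¹ • (N * ((X * Xᵀ) * N)) - N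

theorem shiftedGram_mul_transpose (hV : Vᵀ * V = 1) (R : Matrix (Fin n) (Fin n) ℝ)
    (s : Fin m → ℝ) (c : ℝ) :
    shiftedGram (R * Vᵀ) s c
      = R * (Vᵀ * diagonal s * V - c • (1 : Matrix (Fin n) (Fin n) ℝ)) * Rᵀ := by
  have h : (diagonal fun i => s i - c) = diagonal s - c • (1 : Matrix (Fin m) (Fin m) ℝ) := by
    rw [smul_one_eq_diagonal, diagonal_sub]
  rw [shiftedGram, h, ← hV, transpose_mul, transpose_transpose]
  simp only [Matrix.mul_sub, Matrix.sub_mul, Matrix.mul_smul, Matrix.smul_mul, Matrix.mul_assoc,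
    Matrix.one_mul]

theorem posDef_shiftedGram (hV : Vᵀ * V = 1) (hR : IsUnit R) {s : Fin m → ℝ} {c : ℝ}
    (h : (Vᵀ * diagonal s * V - c • (1 : Matrix (Fin n) (Fin n) ℝ)).PosDef) :
    (shiftedGram (R * Vᵀ) s c).PosDef := by
  rw [shiftedGram_mul_transpose hV]
  simpa [star_eq_conjTranspose] using (Matrix.IsUnit.posDef_star_right_conjugate_iff hR).2 h

theorem inv_shiftedGram_mul_transpose (hV : Vᵀ * V = 1) (R : Matrix (Fin n) (Fin n) ℝ)
    (s : Fin m → ℝ) (c : ℝ) :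
    (shiftedGram (R * Vᵀ) s c)⁻¹
      = (Rᵀ)⁻¹ * (Vᵀ * diagonal s * V - c • (1 : Matrix (Fin n) (Fin n) ℝ))⁻¹ * R⁻¹ := by
  rw [shiftedGram_mul_transpose hV, Matrix.mul_inv_rev, Matrix.mul_inv_rev,
    Matrix.mul_assoc (Rᵀ)⁻¹]

theorem inv_conj_mul_mul_transpose (hR : IsUnit R) (N : Matrix (Fin n) (Fin n) ℝ) :
    (Rᵀ)⁻¹ * N * R⁻¹ * (R * Rᵀ) = (Rᵀ)⁻¹ * N * Rᵀ := by
  rw [Matrix.mul_assoc, ← Matrix.mul_assoc R⁻¹,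
    Matrix.nonsing_inv_mul _ ((isUnit_iff_isUnit_det R).1 hR), Matrix.one_mul]

theorem trace_inv_shiftedGram_mul (hV : Vᵀ * V = 1) (hR : IsUnit R) (s : Fin m → ℝ) (c : ℝ) :
    ((shiftedGram (R * Vᵀ) s c)⁻¹ * (R * Rᵀ)).trace
      = lowerPotential c (Vᵀ * diagonal s * V) := by
  have hRT : IsUnit (Rᵀ).det := by rwa [det_transpose, ← isUnit_iff_isUnit_det]
  rw [inv_shiftedGram_mul_transpose hV, inv_conj_mul_mul_transpose hR, Matrix.mul_assoc,
    Matrix.trace_mul_comm, Matrix.mul_assoc, Matrix.mul_nonsing_inv _ hRT, Matrix.mul_one,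
    lowerPotential]

theorem mulVec_dotProduct_inv_conj_mulVec (hR : IsUnit R) (N : Matrix (Fin n) (Fin n) ℝ)
    (v : Fin n → ℝ) : (R *ᵥ v) ⬝ᵥ (((Rᵀ)⁻¹ * N * R⁻¹) *ᵥ (R *ᵥ v)) = v ⬝ᵥ (N *ᵥ v) := by
  have hRdet := (isUnit_iff_isUnit_det R).1 hR
  have hRT : IsUnit (Rᵀ).det := by rwa [det_transpose]
  rw [mulVec_mulVec, Matrix.mul_assoc, Matrix.nonsing_inv_mul _ hRdet, Matrix.mul_one,
    ← vecMul_transpose, ← dotProduct_mulVec, mulVec_mulVec, ← Matrix.mul_assoc,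
    Matrix.mul_nonsing_inv _ hRT, Matrix.one_mul]

theorem lowerGain_eq_gainMatrix (hV : Vᵀ * V = 1) (hR : IsUnit R) (s : Fin m → ℝ) (L : ℝ)
    (j : Fin m) :
    lowerGain (V j) 1 (Vᵀ * diagonal s * V) L
      = (R * Vᵀ)ᵀ j ⬝ᵥ (gainMatrix (R * Vᵀ) s L *ᵥ (R * Vᵀ)ᵀ j) := by
  have hRT : IsUnit (Rᵀ).det := by rwa [det_transpose, ← isUnit_iff_isUnit_det]
  have gram_eq : (R * Vᵀ) * (R * Vᵀ)ᵀ = R * Rᵀ := by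
    rw [transpose_mul, transpose_transpose, Matrix.mul_assoc, ← Matrix.mul_assoc Vᵀ, hV,
      Matrix.one_mul]
  have col_eq : (R * Vᵀ)ᵀ j = R *ᵥ V j := by
    rw [transpose_mul, transpose_transpose, mul_apply_eq_vecMul, vecMul_transpose]
  have sq_eq (N : Matrix (Fin n) (Fin n) ℝ) :
      (Rᵀ)⁻¹ * N * R⁻¹ * (R * Rᵀ * ((Rᵀ)⁻¹ * N * R⁻¹)) = (Rᵀ)⁻¹ * (N * N) * R⁻¹ := by
    rw [← Matrix.mul_assoc, inv_conj_mul_mul_transpose hR]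
    simp only [Matrix.mul_assoc, Matrix.mul_nonsing_inv_cancel_left _ _ hRT]
  simp only [lowerGain, gainMatrix]
  rw [gram_eq, Matrix.sub_mul, trace_sub, trace_inv_shiftedGram_mul hV hR,
    trace_inv_shiftedGram_mul hV hR, col_eq, sub_mulVec, dotProduct_sub, smul_mulVec,
    dotProduct_smul, inv_shiftedGram_mul_transpose hV, sq_eq,
    mulVec_dotProduct_inv_conj_mulVec hR, mulVec_dotProduct_inv_conj_mulVec hR, smul_eq_mul,
    inv_mul_eq_div]

end LowerGain

section UpperGain

open Matrix

variable {m : ℕ} {s : Fin m → ℝ} {T δ : ℝ}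

theorem inv_smul_one_sub_diagonal (hs : ∀ i, s i < T) :
    (T • (1 : Matrix (Fin m) (Fin m) ℝ) - diagonal s)⁻¹ = diagonal fun i => (T - s i)⁻¹ := by
  refine Matrix.inv_eq_right_inv ?_
  rw [smul_one_eq_diagonal, diagonal_sub, diagonal_mul_diagonal, ← diagonal_one]
  exact congrArg diagonal (funext fun i => mul_inv_cancel₀ (sub_pos.2 (hs i)).ne')

theorem upperPotential_diagonal (hs : ∀ i, s i < T) :
    upperPotential T (diagonal s) = ∑ i, (T - s i)⁻¹ := by
  rw [upperPotential, inv_smul_one_sub_diagonal hs, trace_diagonal]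

theorem upperGain_one_diagonal (hδ : 0 < δ) (hs : ∀ i, s i < T) (j : Fin m) :
    upperGain ((1 : Matrix (Fin m) (Fin m) ℝ) j) δ (diagonal s) T
      = (T + δ - s j)⁻¹ * (T + δ - s j)⁻¹ / (∑ i, (T - s i)⁻¹ - ∑ i, (T + δ - s i)⁻¹)
        + (T + δ - s j)⁻¹ := by
  have hsδ : ∀ i, s i < T + δ := fun i => (hs i).trans (by linarith)
  have form_eq (d : Fin m → ℝ) :
      (1 : Matrix (Fin m) (Fin m) ℝ) j ⬝ᵥ (diagonal d *ᵥ (1 : Matrix (Fin m) (Fin m) ℝ) j)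
        = d j := by
    rw [← single_one_eq_one]
    simp
  simp only [upperGain]
  rw [upperPotential_diagonal hs, upperPotential_diagonal hsδ, inv_smul_one_sub_diagonal hsδ,
    diagonal_mul_diagonal, form_eq, form_eq]

end UpperGain

end DualSet

/-! ### Inversion by successive replacement of rows -/

section RowReplacement

open Matrix

/-- The first `p` rows of `M`, followed by rows of the identity matrix: the intermediate matrices
when the rows of the identity are replaced by those of `M` one at a time. -/
def topRows {K : Type*} [Zero K] [One K] {n : ℕ} (M : Matrix (Fin n) (Fin n) K) (p : ℕ) :
    Matrix (Fin n) (Fin n) K :=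
  fun i => if (i : ℕ) < p then M i else (1 : Matrix (Fin n) (Fin n) K) i

theorem topRows_zero {K : Type*} [Zero K] [One K] {n : ℕ} (M : Matrix (Fin n) (Fin n) K) :
    topRows M 0 = 1 := by
  ext i j; simp [topRows]

theorem topRows_self {K : Type*} [Zero K] [One K] {n : ℕ} (M : Matrix (Fin n) (Fin n) K) :
    topRows M n = M := by
  ext i j; simp [topRows]

theorem topRows_succ {K : Type*} [Ring K] {n : ℕ} (M : Matrix (Fin n) (Fin n) K) (p : Fin n) :
    topRows M (p + 1)
      = topRows M p + vecMulVec (Pi.single p 1) (M p - (1 : Matrix (Fin n) (Fin n) K) p) := by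
  ext i j
  rcases eq_or_ne i p with rfl | hip
  · simp [topRows, vecMulVec_apply]
  · have h : (i : ℕ) < p + 1 ↔ (i : ℕ) < p := by
      rw [Nat.lt_succ_iff_lt_or_eq, or_iff_left (Fin.val_injective.ne hip)]
    simp [topRows, h, vecMulVec_apply, hip]

theorem isUnit_topRows {n : ℕ} {M : Matrix (Fin n) (Fin n) ℝ} (hM : M.PosDef) (p : ℕ) :
    IsUnit (topRows M p) := by
  refine mulVec_injective_iff_isUnit.1 <|
    (injective_iff_map_eq_zero (topRows M p).mulVecLin).2 fun x hx => ?_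
  by_contra hx0
  refine (hM.dotProduct_mulVec_pos hx0).ne' (Finset.sum_eq_zero fun i _ => ?_)
  have hxi : topRows M p i ⬝ᵥ x = 0 := congrFun hx i
  by_cases hi : (i : ℕ) < p
  · rw [topRows, if_pos hi] at hxi
    exact mul_eq_zero_of_right _ hxi
  · rw [topRows, if_neg hi] at hxi
    have hxi : x i = 0 := (congrFun (one_mulVec x) i).symm.trans hxi
    simp [hxi]

theorem inv_add_single_vecMulVec_apply {K ι : Type*} [Field K] [Fintype ι] [DecidableEq ι]
    {A : Matrix ι ι K} {p : ι} {r : ι → K} (hA : IsUnit A)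
    (hAr : IsUnit (A + vecMulVec (Pi.single p 1) r)) (i j : ι) :
    (A + vecMulVec (Pi.single p 1) r)⁻¹ i j
      = A⁻¹ i j - A⁻¹ i p * (r ᵥ* A⁻¹) j / (1 + (r ᵥ* A⁻¹) p) := by
  have h := (isUnit_add_vecMulVec_iff hA _ _).1 hAr
  rw [inv_add_vecMulVec hA h, dotProduct_mulVec, dotProduct_single_one, mulVec_single_one,
    Matrix.sub_apply, Matrix.smul_apply, vecMulVec_apply, smul_eq_mul, col_apply, inv_mul_eq_div]

theorem inv_topRows_succ_apply {n : ℕ} {M : Matrix (Fin n) (Fin n) ℝ} (hM : M.PosDef)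
    (p i j : Fin n) :
    (topRows M (p + 1))⁻¹ i j = (topRows M p)⁻¹ i j -
      (topRows M p)⁻¹ i p *
        ((M p - (1 : Matrix (Fin n) (Fin n) ℝ) p) ᵥ* (topRows M p)⁻¹) j /
        (1 + ((M p - (1 : Matrix (Fin n) (Fin n) ℝ) p) ᵥ* (topRows M p)⁻¹) p) := by
  rw [topRows_succ]
  exact inv_add_single_vecMulVec_apply (isUnit_topRows hM p)
    (topRows_succ M p ▸ isUnit_topRows hM (p + 1)) i j

end RowReplacement

/-! ### Program logic with frames and costs -/

namespace RealRAM

variable {R A R' A' : Finset ℕ} {s s' t : Store}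

/-- The stores `s` and `s'` agree outside the registers in `R` and the arrays in `A`. -/
structure Frame (R A : Finset ℕ) (s s' : Store) : Prop where
  reg : ∀ r ∉ R, s'.reg r = s.reg r
  arr : ∀ a ∉ A, s'.arr a = s.arr a

namespace Frame

theorem refl (s : Store) : Frame R A s s :=
  ⟨fun _ _ => rfl, fun _ _ => rfl⟩

theorem mono (h : Frame R A s s') (hR : R ⊆ R') (hA : A ⊆ A') : Frame R' A' s s' :=
  ⟨fun r hr => h.reg r (mt (@hR r) hr), fun a ha => h.arr a (mt (@hA a) ha)⟩

theorem trans (h : Frame R A s s') (h' : Frame R' A' s' t) : Frame (R ∪ R') (A ∪ A') s t := by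
  refine ⟨fun r hr => ?_, fun a ha => ?_⟩
  · rw [Finset.mem_union, not_or] at hr
    exact (h'.reg r hr.2).trans (h.reg r hr.1)
  · rw [Finset.mem_union, not_or] at ha
    exact (h'.arr a ha.2).trans (h.arr a ha.1)

theorem trans_same (h : Frame R A s s') (h' : Frame R A s' t) : Frame R A s t := by
  simpa only [Finset.union_self] using h.trans h'

theorem setReg {x : ℕ} (hx : x ∈ R) (s : Store) (v : ℕ) : Frame R A s (s.setReg x v) :=
  ⟨fun _ hr => Function.update_of_ne (ne_of_mem_of_not_mem hx hr).symm _ _, fun _ _ => rfl⟩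

theorem setCell {a : ℕ} (ha : a ∈ A) (s : Store) (i j : ℕ) (r : ℝ) :
    Frame R A s (s.setCell a i j r) := by
  refine ⟨fun _ _ => rfl, fun b hb => ?_⟩
  simp [Store.setCell, (ne_of_mem_of_not_mem ha hb).symm]

end Frame

/-- Started in the store `s`, the program `c` changes only the registers in `R` and the arrays in
`A`, performs at most `K` operations, and ends in a store satisfying `Q`. -/
structure Spec (R A : Finset ℕ) (c : Prog) (s : Store) (K : ℕ) (Q : Store → Prop) : Prop where
  frame : Frame R A s (c.run s).1
  cost_le : (c.run s).2 ≤ K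
  post : Q (c.run s).1

namespace Spec

variable {K K₁ K₂ : ℕ} {P Q : Store → Prop} {c c₁ c₂ : Prog}

theorem mono (h : Spec R A c s K₁ P) (hR : R ⊆ R') (hA : A ⊆ A') (hK : K₁ ≤ K₂)
    (hPQ : ∀ s', Frame R A s s' → P s' → Q s') : Spec R' A' c s K₂ Q :=
  ⟨h.frame.mono hR hA, h.cost_le.trans hK, hPQ _ h.frame h.post⟩

theorem seq (h₁ : Spec R A c₁ s K₁ P)
    (h₂ : ∀ s', Frame R A s s' → P s' → Spec R' A' c₂ s' K₂ Q) :
    Spec (R ∪ R') (A ∪ A') (c₁.seq c₂) s (K₁ + K₂) Q :=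
  have h := h₂ _ h₁.frame h₁.post
  ⟨h₁.frame.trans h.frame, Nat.add_le_add h₁.cost_le h.cost_le, h.post⟩

theorem loop {x d p : ℕ} (I : ℕ → Store → Prop) (hx : x ∈ R) (hd : s.reg d = p)
    (hI : ∀ i s' v, I i s' → I i (s'.setReg x v)) (h₀ : I 0 s)
    (hstep : ∀ (i : Fin p) (s' : Store), Frame R A s s' → s'.reg x = i → I i s' →
      Spec R A c s' K (I (i + 1))) :
    Spec R A (.loop x (.var d) c) s (2 + p * (K + 1)) (I p) := by
  subst hd
  let body : Store × ℕ → ℕ → Store × ℕ := fun r i =>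
    ((c.run (r.1.setReg x i)).1, r.2 + (c.run (r.1.setReg x i)).2 + 1)
  let after (q : ℕ) : Store × ℕ := (List.range q).foldl body (s, 2)
  suffices key : ∀ q ≤ s.reg d,
      Frame R A s (after q).1 ∧ (after q).2 ≤ 2 + q * (K + 1) ∧ I q (after q).1 from
    let ⟨frame, cost_le, post⟩ := key _ le_rfl
    ⟨frame, cost_le, post⟩
  intro q
  induction q with
  | zero => exact fun _ => ⟨.refl s, Nat.le_add_right 2 _, h₀⟩
  | succ q ih =>
    intro hq
    obtain ⟨frame, cost_le, post⟩ := ih (Nat.le_of_succ_le hq)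
    have frame' := frame.trans_same (.setReg hx _ q)
    have h := hstep ⟨q, hq⟩ _ frame' (Function.update_self (β := fun _ => ℕ) x q _) (hI _ _ _ post)
    have after_succ : after (q + 1) = body (after q) q := by
      simp only [after, List.range_succ, List.foldl_append, List.foldl_cons, List.foldl_nil]
    rw [after_succ]
    refine ⟨frame'.trans_same h.frame, ?_, h.post⟩
    calc (after q).2 + (c.run ((after q).1.setReg x q)).2 + 1
        ≤ (2 + q * (K + 1)) + K + 1 := by gcongr; exact h.cost_le
      _ = 2 + (q + 1) * (K + 1) := by ring

end Spec

theorem eval_sum_var {x d q : ℕ} {e : RExp} (hd : s.reg d = q) :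
    (RExp.sum x (.var d) e).eval s = ∑ i : Fin q, e.eval (s.setReg x i) := by
  rw [RExp.eval, NExp.eval, hd, Finset.sum_range]

theorem cost_sum_var_le {x d q c : ℕ} {e : RExp} (hd : s.reg d = q)
    (hc : ∀ i : Fin q, e.cost (s.setReg x i) ≤ c) :
    (RExp.sum x (.var d) e).cost s ≤ 2 + q * (c + 2) := by
  rw [RExp.cost, NExp.eval, hd, Finset.sum_range]
  gcongr
  · rfl
  · calc ∑ i : Fin q, (e.cost (s.setReg x i) + 2) ≤ ∑ _i : Fin q, (c + 2) := by
          gcongr with i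
          exact hc i
      _ = q * (c + 2) := by simp

/-- The upper left corner of array `a` holds the matrix `M`. -/
def HasMat {p q : ℕ} (s : Store) (a : ℕ) (M : Matrix (Fin p) (Fin q) ℝ) : Prop :=
  ∀ (i : Fin p) (j : Fin q), s.arr a i j = M i j

/-- Row `0` of array `a` starts with the entries of `v`. -/
def HasVec {q : ℕ} (s : Store) (a : ℕ) (v : Fin q → ℝ) : Prop :=
  ∀ j : Fin q, s.arr a 0 j = v j

theorem HasMat.frame {p q a : ℕ} {M : Matrix (Fin p) (Fin q) ℝ} (h : HasMat s a M)
    (hf : Frame R A s s') (ha : a ∉ A) : HasMat s' a M :=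
  fun i j => by rw [hf.arr a ha]; exact h i j

theorem HasVec.frame {q a : ℕ} {v : Fin q → ℝ} (h : HasVec s a v)
    (hf : Frame R A s s') (ha : a ∉ A) : HasVec s' a v :=
  fun j => by rw [hf.arr a ha]; exact h j

/-! ### Matrix routines -/

/-- Assign the value of `e`, for each value of register `5` below the content of register `d`, to
the entry of array `a` in row `i` and column number `5`. -/
def fillRow (a : ℕ) (i : NExp) (d : ℕ) (e : RExp) : Prog :=
  .loop 5 (.var d) (.setR a i (.var 5) e)

/-- Assign the value of `e`, for all values of registers `4` and `5` below the contents of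
registers `d₁` and `d₂`, to the entry of array `a` in row number `4` and column number `5`. -/
def fill (a d₁ d₂ : ℕ) (e : RExp) : Prog :=
  .loop 4 (.var d₁) (fillRow a (.var 4) d₂ e)

/-- Copy the square matrix in array `src`, whose size is in register `0`, to array `dst`. -/
def copy (src dst : ℕ) : Prog :=
  fill dst 0 0 (.cell src (.var 4) (.var 5))

/-- The entry in row number `i` and column number `j` of the product of the matrices in arrays `a`
and `b`, with the inner dimension in register `d` and summation index in register `7`. -/
def mulExp (d a i b j : ℕ) : RExp :=
  .sum 7 (.var d) (.mul (.cell a (.var i) (.var 7)) (.cell b (.var 7) (.var j)))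

theorem spec_fillRow {a d q c r : ℕ} {i : NExp} {e : RExp} (v : Fin q → ℝ) (hd : s.reg d = q)
    (hi : i.cost = 1) (hir : ∀ s', Frame {5} {a} s s' → i.eval s' = r)
    (he : ∀ s' (j : Fin q), Frame {5} {a} s s' → s'.reg 5 = j →
      e.eval s' = v j ∧ e.cost s' ≤ c) :
    Spec {5} {a} (fillRow a i d e) s (2 + q * (c + 4)) fun s' =>
      (∀ j : Fin q, s'.arr a r j = v j) ∧ ∀ i' ≠ r, s'.arr a i' = s.arr a i' := by
  refine (Spec.loop (K := c + 3)
    (fun t s' => (∀ j : Fin q, (j : ℕ) < t → s'.arr a r j = v j) ∧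
      ∀ i' ≠ r, s'.arr a i' = s.arr a i')
    (Finset.mem_singleton_self 5) hd (fun _ _ _ h => h)
    ⟨fun _ hj => absurd hj (Nat.not_lt_zero _), fun _ _ => rfl⟩ fun t s₁ hf h5 h => ?_).mono
    subset_rfl subset_rfl le_rfl fun _ _ h => ⟨fun j => h.1 j j.2, h.2⟩
  obtain ⟨hev, hcost⟩ := he s₁ t hf h5
  refine ⟨.setCell (Finset.mem_singleton_self a) _ _ _ _, ?_, fun j hj => ?_, fun i' hi' => ?_⟩
  · simp only [Prog.run, NExp.cost, hi]
    omega
  · simp only [Prog.run, Store.setCell, NExp.eval, hir s₁ hf, h5, hev, true_and, Fin.val_inj]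
    split_ifs with hjt
    · rw [hjt]
    · exact h.1 j (lt_of_le_of_ne (Nat.lt_succ_iff.1 hj) (Fin.val_injective.ne hjt))
  · rw [← h.2 i' hi']
    funext j'
    simp [Prog.run, Store.setCell, hir s₁ hf, hi']

theorem spec_fillRow_zero {a d q c : ℕ} {e : RExp} (v : Fin q → ℝ) (hd : s.reg d = q)
    (he : ∀ s' (j : Fin q), Frame {5} {a} s s' → s'.reg 5 = j →
      e.eval s' = v j ∧ e.cost s' ≤ c) :
    Spec {5} {a} (fillRow a (.lit 0) d e) s (2 + q * (c + 4)) fun s' => HasVec s' a v :=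
  (spec_fillRow v hd rfl (fun _ _ => rfl) he).mono subset_rfl subset_rfl le_rfl fun _ _ h => h.1

theorem spec_fill {a d₁ d₂ p q c : ℕ} {e : RExp} (M : Matrix (Fin p) (Fin q) ℝ)
    (h₁ : s.reg d₁ = p) (h₂ : s.reg d₂ = q) (hd₂ : d₂ ∉ ({4, 5} : Finset ℕ))
    (he : ∀ s' (i : Fin p) (j : Fin q), Frame {4, 5} {a} s s' → s'.reg 4 = i → s'.reg 5 = j →
      e.eval s' = M i j ∧ e.cost s' ≤ c) :
    Spec {4, 5} {a} (fill a d₁ d₂ e) s (2 + p * (3 + q * (c + 4))) fun s' => HasMat s' a M := by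
  refine (Spec.loop (K := 2 + q * (c + 4))
    (fun r s' => ∀ (i : Fin p) (j : Fin q), (i : ℕ) < r → s'.arr a i j = M i j)
    (by decide) h₁ (fun _ _ _ h => h) (fun _ _ hi => absurd hi (Nat.not_lt_zero _))
    fun r s₁ hf h4 h => ?_).mono subset_rfl subset_rfl (le_of_eq (by ring))
    fun _ _ h i j => h i j i.2
  have hf' : ∀ s₂, Frame {5} {a} s₁ s₂ → Frame {4, 5} {a} s s₂ := fun _ h =>
    hf.trans_same (h.mono (by decide) subset_rfl)
  have h4' : ∀ s₂, Frame {5} {a} s₁ s₂ → s₂.reg 4 = r := fun _ h =>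
    (h.reg 4 (by decide)).trans h4
  refine (spec_fillRow (M r) ((hf.reg d₂ hd₂).trans h₂) rfl h4'
    fun s₂ j hf₂ h5 => he s₂ r j (hf' s₂ hf₂) (h4' s₂ hf₂) h5).mono
    (by decide) subset_rfl le_rfl fun s₂ _ hs₂ i j hi => ?_
  rcases eq_or_ne i r with rfl | hir
  · exact hs₂.1 j
  · have hne := Fin.val_injective.ne hir
    rw [hs₂.2 i hne]
    exact h i j (lt_of_le_of_ne (Nat.lt_succ_iff.1 hi) hne)

theorem spec_copy {n src dst : ℕ} {M : Matrix (Fin n) (Fin n) ℝ} (h0 : s.reg 0 = n)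
    (hM : HasMat s src M) (hne : src ≠ dst) :
    Spec {4, 5} {dst} (copy src dst) s (2 + n * (3 + n * 7)) fun s' => HasMat s' dst M := by
  refine spec_fill (c := 3) M h0 h0 (by decide) fun s' i j hf h4 h5 => ⟨?_, by rfl⟩
  rw [RExp.eval, NExp.eval, NExp.eval, h4, h5]
  exact hM.frame hf (by simpa using hne) i j

theorem eval_mulExp {d a i b j p q r : ℕ} {M : Matrix (Fin p) (Fin q) ℝ}
    {N : Matrix (Fin q) (Fin r) ℝ} {i' : Fin p} {j' : Fin r} (hd : s.reg d = q)
    (hM : HasMat s a M) (hN : HasMat s b N) (hi : s.reg i = i') (hj : s.reg j = j')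
    (hi7 : i ≠ 7) (hj7 : j ≠ 7) : (mulExp d a i b j).eval s = (M * N) i' j' := by
  rw [mulExp, eval_sum_var hd, Matrix.mul_apply]
  refine Finset.sum_congr rfl fun l _ => ?_
  simp only [RExp.eval, NExp.eval, Store.setReg, Function.update_self,
    Function.update_of_ne hi7, Function.update_of_ne hj7, hi, hj]
  exact congrArg₂ (· * ·) (hM i' l) (hN l j')

theorem cost_mulExp_le {d q : ℕ} (a i b j : ℕ) (hd : s.reg d = q) :
    (mulExp d a i b j).cost s ≤ 2 + q * 9 :=
  cost_sum_var_le hd fun _ => by rfl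

end RealRAM

/-! ### Matrix inversion -/

namespace RealRAM

open Matrix

/-- Store in array `3` the identity matrix of the size in register `0`. -/
def setIdentity : Prog :=
  .seq (fill 3 0 0 (.ofNat (.lit 0)))
    (.loop 6 (.var 0) (.setR 3 (.var 6) (.var 6) (.ofNat (.lit 1))))

/-- Replace the matrix `(topRows M p)⁻¹` in array `3` by `(topRows M (p + 1))⁻¹`, where `M` is in
array `2` and `p` is in register `6`; arrays `4` and `5` are used as workspace. -/
def replaceRow : Prog :=
  .seq (fillRow 4 (.lit 0) 0 (.sub (mulExp 0 2 6 3 5) (.cell 3 (.var 6) (.var 5)))) <|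
  .seq (fill 5 0 0 (.sub (.cell 3 (.var 4) (.var 5))
    (.div (.mul (.cell 3 (.var 4) (.var 6)) (.cell 4 (.lit 0) (.var 5)))
      (.add (.ofNat (.lit 1)) (.cell 4 (.lit 0) (.var 6)))))) <|
  copy 5 3

/-- Store in array `3` the inverse of the matrix in array `2`, whose size is in register `0`. -/
def invert : Prog :=
  .seq setIdentity (.loop 6 (.var 0) replaceRow)

variable {n : ℕ} {s : Store}

theorem spec_setIdentity (h0 : s.reg 0 = n) :
    Spec {4, 5, 6} {3} setIdentity s (2 + n * (3 + n * 6) + (2 + n * 6))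
      fun s' => HasMat s' 3 (1 : Matrix (Fin n) (Fin n) ℝ) := by
  refine (Spec.seq (R' := {6}) (A' := {3}) (spec_fill (c := 2) (0 : Matrix (Fin n) (Fin n) ℝ)
    h0 h0 (by decide) fun s' i j _ _ _ => ⟨by simp [RExp.eval, NExp.eval], by rfl⟩)
    fun s₁ hf₁ hz => Spec.loop (K := 5)
      (fun p s' => ∀ i j : Fin n, s'.arr 3 i j = if i = j ∧ (i : ℕ) < p then 1 else 0)
      (Finset.mem_singleton_self 6) ((hf₁.reg 0 (by decide)).trans h0) (fun _ _ _ h => h)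
      (fun i j => by simpa using hz i j)
      fun p s₂ _ h6 hs₂ => ⟨.setCell (Finset.mem_singleton_self 3) _ _ _ _, by rfl,
        fun i j => ?_⟩).mono (by decide) (by decide) le_rfl
    fun s' _ h i j => by simp [h i j, one_apply]
  simp only [Prog.run, NExp.eval, RExp.eval, Store.setCell, h6, true_and, hs₂ i j, Nat.cast_one,
    Fin.val_inj, Nat.lt_succ_iff_lt_or_eq]
  grind

theorem spec_replaceRow {M : Matrix (Fin n) (Fin n) ℝ} (hM : M.PosDef) (p : Fin n)
    (h0 : s.reg 0 = n) (h6 : s.reg 6 = p) (h2 : HasMat s 2 M) (h3 : HasMat s 3 (topRows M p)⁻¹) :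
    Spec {4, 5} {3, 4, 5} replaceRow s
      (2 + n * (9 * n + 10) + (2 + n * (3 + n * 22) + (2 + n * (3 + n * 7))))
      fun s' => HasMat s' 3 (topRows M (p + 1))⁻¹ := by
  set N := (topRows M p)⁻¹
  set w := (M p - (1 : Matrix (Fin n) (Fin n) ℝ) p) ᵥ* N with hw
  have w_apply (j : Fin n) : w j = (M * N) p j - N p j := by
    rw [hw, sub_vecMul]
    exact congrArg ((M p ᵥ* N) j - ·) (congrFun (congrFun (Matrix.one_mul N) p) j)
  refine (Spec.seq (spec_fillRow (c := 9 * n + 6) w h0 rfl (fun _ _ => rfl)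
    fun s₁ j hf₁ h5 => ?_) fun s₁ hf₁ h₁ => Spec.seq (spec_fill (c := 18)
      (topRows M (p + 1))⁻¹ ((hf₁.reg 0 (by decide)).trans h0)
      ((hf₁.reg 0 (by decide)).trans h0) (by decide) fun s₂ i j hf₂ h4 h5 => ?_)
    fun s₂ hf₂ h₂ => spec_copy ((hf₂.reg 0 (by decide)).trans ((hf₁.reg 0 (by decide)).trans h0))
      h₂ (by decide)).mono (by decide) (by decide) (by ring_nf; rfl) fun _ _ h => h
  · have h0' := (hf₁.reg 0 (by decide)).trans h0
    have h6' := (hf₁.reg 6 (by decide)).trans h6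
    constructor
    · rw [RExp.eval, eval_mulExp h0' (h2.frame hf₁ (by decide)) (h3.frame hf₁ (by decide)) h6' h5
        (by decide) (by decide), RExp.eval, NExp.eval, NExp.eval, h6', h5,
        h3.frame hf₁ (by decide) p j, w_apply]
    · have := cost_mulExp_le 2 6 3 5 h0'
      simp only [RExp.cost, NExp.cost]
      omega
  · have h6' := (hf₂.reg 6 (by decide)).trans ((hf₁.reg 6 (by decide)).trans h6)
    have h3' := (h3.frame hf₁ (by decide)).frame hf₂ (by decide)
    have hw' (j : Fin n) : s₂.arr 4 0 j = w j := HasVec.frame h₁.1 hf₂ (by decide) j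
    refine ⟨?_, by rfl⟩
    simp only [RExp.eval, NExp.eval, h4, h5, h6', h3' _ _, hw', Nat.cast_one]
    exact (inv_topRows_succ_apply hM p i j).symm

theorem spec_invert {M : Matrix (Fin n) (Fin n) ℝ} (hM : M.PosDef) (hn : 0 < n)
    (h0 : s.reg 0 = n) (h2 : HasMat s 2 M) :
    Spec {4, 5, 6} {3, 4, 5} invert s (90 * n ^ 3) fun s' => HasMat s' 3 M⁻¹ := by
  refine (Spec.seq (spec_setIdentity h0) fun s₁ hf₁ h₁ => Spec.loop (R := {4, 5, 6})
    (A := {3, 4, 5}) (fun p s' => HasMat s' 3 (topRows M p)⁻¹) (by decide)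
    ((hf₁.reg 0 (by decide)).trans h0) (fun _ _ _ h => h) (by rwa [topRows_zero, inv_one])
    fun p s₂ hf₂ h6 h₂ =>
      (spec_replaceRow hM p ((hf₂.reg 0 (by decide)).trans ((hf₁.reg 0 (by decide)).trans h0)) h6
        ((h2.frame hf₁ (by decide)).frame hf₂ (by decide)) h₂).mono (by decide) (by decide) le_rfl
        fun _ _ h => h).mono (by decide) (by decide) ?_ fun s' _ h => by rwa [topRows_self] at h
  have : n ≤ n ^ 2 := Nat.le_self_pow two_ne_zero n
  have : n ^ 2 ≤ n ^ 3 := Nat.pow_le_pow_right hn (by decide)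
  linarith

end RealRAM

/-! ### The selection program -/

namespace RealRAM

open Matrix DualSet

/-- The level of the lower barrier in the iteration whose number is in register `3`. -/
def lowExp : RExp :=
  .sub (.ofNat (.var 3)) (.sqrt (.mul (.ofNat (.var 0)) (.ofNat (.var 2))))

/-- The increment of the upper barrier. -/
def stepExp : RExp :=
  .div (.add (.ofNat (.lit 1)) (.sqrt (.div (.ofNat (.var 1)) (.ofNat (.var 2)))))
    (.sub (.ofNat (.lit 1)) (.sqrt (.div (.ofNat (.var 0)) (.ofNat (.var 2)))))

/-- The level of the upper barrier in the iteration whose number is in register `3`. -/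
def topExp : RExp :=
  .mul stepExp (.add (.ofNat (.var 3)) (.sqrt (.mul (.ofNat (.var 1)) (.ofNat (.var 2)))))

/-- Store the Gram matrix `X Xᵀ` in array `6`. -/
def gram : Prog :=
  fill 6 0 0 (.sum 7 (.var 1) (.mul (.cell 0 (.var 4) (.var 7)) (.cell 0 (.var 5) (.var 7))))

/-- Store in array `3` the inverse of `X diag(s - c) Xᵀ`. -/
def shiftedInverse (c : RExp) : Prog :=
  .seq (fill 2 0 0 (.sum 7 (.var 1)
    (.mul (.mul (.cell 0 (.var 4) (.var 7)) (.sub (.cell 1 (.var 7) (.lit 0)) c))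
      (.cell 0 (.var 5) (.var 7)))))
    invert

/-- Store `X Xᵀ` in array `6`, and the inverses of `X diag(s - L) Xᵀ` and `X diag(s - L - 1) Xᵀ`,
where `L` is the level of the lower barrier, in arrays `7` and `3`. -/
def lowerResolvents : Prog :=
  .seq gram <|
  .seq (shiftedInverse lowExp) <|
  .seq (copy 3 7) <|
  shiftedInverse (.add lowExp (.ofNat (.lit 1)))

/-- The trace of the product of the difference of the matrices in arrays `3` and `7` with the matrix
in array `6`. -/
def traceGapExp : RExp :=
  .sum 7 (.var 0) (.sum 8 (.var 0)
    (.mul (.sub (.cell 3 (.var 7) (.var 8)) (.cell 7 (.var 7) (.var 8)))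
      (.cell 6 (.var 8) (.var 7))))

/-- Compute from the results of `lowerResolvents` the matrix `gainMatrix` in array `10`. -/
def assembleGainMatrix : Prog :=
  .seq (fill 8 0 0 (mulExp 0 6 4 3 5)) <|
  .seq (.setR 9 (.lit 0) (.lit 0) traceGapExp) <|
  fill 10 0 0 (.sub (.div (mulExp 0 3 4 8 5) (.cell 9 (.lit 0) (.lit 0)))
    (.cell 3 (.var 4) (.var 5)))

/-- The value of the quadratic form in array `10` at column number `5` of array `0`. -/
def quadraticFormExp : RExp :=
  .sum 7 (.var 0) (.sum 8 (.var 0)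
    (.mul (.cell 0 (.var 7) (.var 5))
      (.mul (.cell 10 (.var 7) (.var 8)) (.cell 0 (.var 8) (.var 5)))))

/-- Store the lower gains in row `0` of array `11`. -/
def lowerGains : Prog :=
  .seq lowerResolvents (.seq assembleGainMatrix (fillRow 11 (.lit 0) 1 quadraticFormExp))

/-- The reciprocal of `c - sⱼ`, where `j` is in register `x`. -/
def gapInvExp (c : RExp) (x : ℕ) : RExp :=
  .div (.ofNat (.lit 1)) (.sub c (.cell 1 (.var x) (.lit 0)))

/-- The decrease of the upper potential of the diagonal matrix of the weights. -/
def upperGapExp : RExp :=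
  .sum 7 (.var 1) (.sub (gapInvExp topExp 7) (gapInvExp (.add topExp stepExp) 7))

/-- Store the upper gains in row `0` of array `13`. -/
def upperGains : Prog :=
  .seq (.setR 12 (.lit 0) (.lit 0) upperGapExp) <|
  fillRow 13 (.lit 0) 1 (.add
    (.div (.mul (gapInvExp (.add topExp stepExp) 5) (gapInvExp (.add topExp stepExp) 5))
      (.cell 12 (.lit 0) (.lit 0)))
    (gapInvExp (.add topExp stepExp) 5))

/-- Put the last index whose upper gain does not exceed its lower gain into register `9`. -/
def selectIndex : Prog :=
  .loop 5 (.var 1) (.ifLe (.cell 13 (.lit 0) (.var 5)) (.cell 11 (.lit 0) (.var 5))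
    (.setN 9 (.var 5)) .skip)

/-- Update the weight of the selected index. -/
def updateWeight : Prog :=
  .setR 1 (.var 9) (.lit 0) (.add (.cell 1 (.var 9) (.lit 0)) (.div (.ofNat (.lit 1))
    (.div (.add (.cell 13 (.lit 0) (.var 9)) (.cell 11 (.lit 0) (.var 9))) (.ofNat (.lit 2)))))

/-- One iteration of dual set spectral sparsification. -/
def iteration : Prog :=
  .seq lowerGains (.seq upperGains (.seq selectIndex updateWeight))

/-- The greedy selection algorithm. The final rescaling of the weights is omitted because it does
not change their support. -/
def greedySelection : Prog :=
  .loop 3 (.var 2) iteration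

/-- The sizes `n`, `m`, `k`, the iteration number `τ`, the input `X` and the weights `w` are in
registers `0` to `3`, in array `0` and in column `0` of array `1`. -/
structure Loaded {n m : ℕ} (X : Matrix (Fin n) (Fin m) ℝ) (w : Fin m → ℝ) (k τ : ℕ) (s : Store) :
    Prop where
  reg_n : s.reg 0 = n
  reg_m : s.reg 1 = m
  reg_k : s.reg 2 = k
  reg_τ : s.reg 3 = τ
  mat : HasMat s 0 X
  weights : ∀ j : Fin m, s.arr 1 j 0 = w j

variable {n m k τ : ℕ} {X : Matrix (Fin n) (Fin m) ℝ} {w : Fin m → ℝ} {s s' : Store}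

namespace Loaded

theorem frame {R A : Finset ℕ} (h : Loaded X w k τ s) (hf : Frame R A s s')
    (hR : ∀ r < 4, r ∉ R) (hA : ∀ a < 2, a ∉ A) : Loaded X w k τ s' where
  reg_n := (hf.reg 0 (hR 0 (by decide))).trans h.reg_n
  reg_m := (hf.reg 1 (hR 1 (by decide))).trans h.reg_m
  reg_k := (hf.reg 2 (hR 2 (by decide))).trans h.reg_k
  reg_τ := (hf.reg 3 (hR 3 (by decide))).trans h.reg_τ
  mat := h.mat.frame hf (hA 0 (by decide))
  weights j := by rw [hf.arr 1 (hA 1 (by decide))]; exact h.weights j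

theorem setReg_seven (h : Loaded X w k τ s) (i : ℕ) : Loaded X w k τ (s.setReg 7 i) :=
  h.frame (R := {7}) (A := ∅) (.setReg (Finset.mem_singleton_self 7) s i) (by decide) (by decide)

theorem eval_lowExp (h : Loaded X w k τ s) : lowExp.eval s = lowerLevel n k τ := by
  simp only [lowExp, lowerLevel, RExp.eval, NExp.eval, h.reg_n, h.reg_k, h.reg_τ]

theorem eval_stepExp (h : Loaded X w k τ s) : stepExp.eval s = upperStep n m k := by
  simp only [stepExp, upperStep, RExp.eval, NExp.eval, h.reg_n, h.reg_m, h.reg_k, Nat.cast_one]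

theorem eval_topExp (h : Loaded X w k τ s) : topExp.eval s = upperLevel n m k τ := by
  simp only [topExp, upperLevel, RExp.eval, NExp.eval, h.eval_stepExp, h.reg_m, h.reg_k, h.reg_τ]

theorem eval_gapInvExp (h : Loaded X w k τ s) (c : RExp) {x : ℕ} {j : Fin m}
    (hx : s.reg x = j) : (gapInvExp c x).eval s = (c.eval s - w j)⁻¹ := by
  simp only [gapInvExp, RExp.eval, NExp.eval, hx, h.weights j, Nat.cast_one, one_div]

theorem initStore (X : Matrix (Fin n) (Fin m) ℝ) (k : ℕ) : Loaded X 0 k 0 (initStore X k) where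
  reg_n := rfl
  reg_m := rfl
  reg_k := rfl
  reg_τ := rfl
  mat i j := by simp [RealRAM.initStore]
  weights j := by simp [RealRAM.initStore]

end Loaded

theorem le_mul_sq (hn : 0 < n) (hnm : n ≤ m) :
    n ^ 3 ≤ m * n ^ 2 ∧ m * n ≤ m * n ^ 2 ∧ m ≤ m * n := by
  refine ⟨?_, Nat.mul_le_mul_left m (Nat.le_self_pow two_ne_zero n), Nat.le_mul_of_pos_right m hn⟩
  rw [pow_succ, mul_comm]
  exact Nat.mul_le_mul_right _ hnm

theorem spec_gram (h : Loaded X w k τ s) :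
    Spec {4, 5} {6} gram s (2 + n * (3 + n * (2 + m * 9 + 4)))
      fun s' => HasMat s' 6 (X * Xᵀ) := by
  refine spec_fill _ h.reg_n h.reg_n (by decide) fun s' i j hf h4 h5 => ?_
  have h' := h.frame hf (by decide) (by decide)
  refine ⟨?_, cost_sum_var_le h'.reg_m fun _ => by rfl⟩
  rw [eval_sum_var h'.reg_m, Matrix.mul_apply]
  refine Finset.sum_congr rfl fun l _ => ?_
  simp [RExp.eval, NExp.eval, Store.setReg, h4, h5, h'.mat _ _]

theorem spec_shiftedInverse {c : RExp} {v : ℝ} (h : Loaded X w k τ s) (hn : 0 < n)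
    (hv : (shiftedGram X w v).PosDef)
    (hc : ∀ s', Loaded X w k τ s' → c.eval s' = v ∧ c.cost s' ≤ 12) :
    Spec {4, 5, 6} {2, 3, 4, 5} (shiftedInverse c) s
      (2 + n * (3 + n * (2 + m * 26 + 4)) + 90 * n ^ 3)
      fun s' => HasMat s' 3 (shiftedGram X w v)⁻¹ := by
  refine (Spec.seq (spec_fill (shiftedGram X w v) h.reg_n h.reg_n (by decide)
    fun s' i j hf h4 h5 => ?_) fun s₁ hf₁ h₁ =>
      spec_invert hv hn ((h.frame hf₁ (by decide) (by decide)).reg_n) h₁).mono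
    (by decide) (by decide) le_rfl fun _ _ h => h
  have h' := h.frame hf (by decide) (by decide)
  constructor
  · rw [eval_sum_var h'.reg_m, shiftedGram, Matrix.mul_apply]
    refine Finset.sum_congr rfl fun l _ => ?_
    simp only [RExp.eval, (hc _ (h'.setReg_seven l)).1]
    simp [NExp.eval, Store.setReg, h4, h5, h'.mat _ _, h'.weights l]
  · refine cost_sum_var_le (c := 24) h'.reg_m fun l => ?_
    have := (hc _ (h'.setReg_seven l)).2
    simp only [RExp.cost, NExp.cost]
    omega

theorem spec_lowerResolvents (h : Loaded X w k τ s) (hn : 0 < n) (hnm : n ≤ m)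
    (hL : (shiftedGram X w (lowerLevel n k τ)).PosDef)
    (hL' : (shiftedGram X w (lowerLevel n k τ + 1)).PosDef) :
    Spec {4, 5, 6} {2, 3, 4, 5, 6, 7} lowerResolvents s (290 * (m * n ^ 2))
      fun s' => HasMat s' 6 (X * Xᵀ) ∧ HasMat s' 7 (shiftedGram X w (lowerLevel n k τ))⁻¹ ∧
        HasMat s' 3 (shiftedGram X w (lowerLevel n k τ + 1))⁻¹ := by
  refine (Spec.seq (spec_gram h) fun s₁ hf₁ h₁ => Spec.seq
    (spec_shiftedInverse (h.frame hf₁ (by decide) (by decide)) hn hL fun s' h' =>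
      ⟨h'.eval_lowExp, by simp [lowExp, RExp.cost, NExp.cost]⟩) fun s₂ hf₂ h₂ => ?_).mono
    (K₁ := _ + (_ + (2 + n * (3 + n * 7) + (2 + n * (3 + n * (2 + m * 26 + 4)) + 90 * n ^ 3))))
    (R := {4, 5} ∪ ({4, 5, 6} ∪ {4, 5, 6})) (A := {6} ∪ ({2, 3, 4, 5} ∪ {2, 3, 4, 5, 7}))
    (by decide) (by decide) ?_ fun _ _ h => h
  · have hs₂ := (h.frame hf₁ (by decide) (by decide)).frame hf₂ (by decide) (by decide)
    refine (Spec.seq (spec_copy hs₂.reg_n h₂ (by decide)) fun s₃ hf₃ h₃ =>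
      (spec_shiftedInverse (hs₂.frame hf₃ (by decide) (by decide)) hn hL'
        fun s' h' => ⟨?_, ?_⟩).mono subset_rfl subset_rfl le_rfl fun s₄ hf₄ h₄ =>
          ⟨((h₁.frame hf₂ (by decide)).frame hf₃ (by decide)).frame hf₄ (by decide),
            h₃.frame hf₄ (by decide), h₄⟩).mono (by decide) (by decide) le_rfl fun _ _ h => h
    · rw [RExp.eval, h'.eval_lowExp, RExp.eval, NExp.eval, Nat.cast_one]
    · simp [lowExp, RExp.cost, NExp.cost]
  · obtain ⟨h₁, h₂, h₃⟩ := le_mul_sq hn hnm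
    nlinarith

theorem eval_traceGapExp {G N N₀ : Matrix (Fin n) (Fin n) ℝ} (h0 : s.reg 0 = n)
    (h6 : HasMat s 6 G) (h7 : HasMat s 7 N₀) (h3 : HasMat s 3 N) :
    traceGapExp.eval s = ((N - N₀) * G).trace := by
  rw [traceGapExp, eval_sum_var h0]
  refine Finset.sum_congr rfl fun i _ => ?_
  rw [eval_sum_var (s := s.setReg 7 i) (d := 0) h0, diag_apply, Matrix.mul_apply]
  refine Finset.sum_congr rfl fun j _ => ?_
  simp [RExp.eval, NExp.eval, Store.setReg, h3 _ _, h6 _ _, h7 _ _]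

theorem cost_traceGapExp_le (h0 : s.reg 0 = n) :
    traceGapExp.cost s ≤ 2 + n * (2 + n * 13 + 2) :=
  cost_sum_var_le h0 fun i => cost_sum_var_le (s := s.setReg 7 i) h0 fun _ => by rfl

theorem spec_assembleGainMatrix {L : ℝ} (h0 : s.reg 0 = n)
    (h6 : HasMat s 6 (X * Xᵀ)) (h7 : HasMat s 7 (shiftedGram X w L)⁻¹)
    (h3 : HasMat s 3 (shiftedGram X w (L + 1))⁻¹) :
    Spec {4, 5} {8, 9, 10} assembleGainMatrix s (9 + n * (10 + n * (33 + n * 18)))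
      fun s' => HasMat s' 10 (gainMatrix X w L) := by
  set N₀ := (shiftedGram X w L)⁻¹
  set N := (shiftedGram X w (L + 1))⁻¹
  have gainMatrix_apply (i j : Fin n) : gainMatrix X w L i j
      = (N * (X * Xᵀ * N)) i j / ((N - N₀) * (X * Xᵀ)).trace - N i j := by
    rw [div_eq_inv_mul]; rfl
  refine (Spec.seq (spec_fill (c := 2 + n * 9) (X * Xᵀ * N) h0 h0 (by decide)
    fun s' i j hf h4 h5 => ?_) fun s₁ hf₁ h₁ => Spec.seq (R := ∅) (A := {9})
      (K₁ := 5 + n * (2 + n * 13 + 2)) (P := fun s' => s'.arr 9 0 0 = ((N - N₀) * (X * Xᵀ)).trace)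
      ⟨.setCell (by decide) _ _ _ _, ?_, ?_⟩ fun s₂ hf₂ h₂ =>
      spec_fill (c := 10 + n * 9) (gainMatrix X w L) ((hf₂.reg 0 (by decide)).trans
        ((hf₁.reg 0 (by decide)).trans h0)) ((hf₂.reg 0 (by decide)).trans
        ((hf₁.reg 0 (by decide)).trans h0)) (by decide) fun s' i j hf h4 h5 => ?_).mono
    (by decide) (by decide) ?_ fun _ _ h => h
  · have h0' := (hf.reg 0 (by decide)).trans h0
    exact ⟨eval_mulExp h0' (h6.frame hf (by decide)) (h3.frame hf (by decide)) h4 h5 (by decide)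
      (by decide), cost_mulExp_le 6 4 3 5 h0'⟩
  · have := cost_traceGapExp_le ((hf₁.reg 0 (by decide)).trans h0)
    simp only [Prog.run, NExp.cost]
    omega
  · simp only [Prog.run, Store.setCell, NExp.eval, and_self, if_true]
    exact eval_traceGapExp ((hf₁.reg 0 (by decide)).trans h0) (h6.frame hf₁ (by decide))
      (h7.frame hf₁ (by decide)) (h3.frame hf₁ (by decide))
  · have h0' := (hf.reg 0 (by decide)).trans
      ((hf₂.reg 0 (by decide)).trans ((hf₁.reg 0 (by decide)).trans h0))
    have h3' := ((h3.frame hf₁ (by decide)).frame hf₂ (by decide)).frame hf (by decide)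
    have h8' := (h₁.frame hf₂ (by decide)).frame hf (by decide)
    constructor
    · simp only [RExp.eval, NExp.eval, eval_mulExp h0' h3' h8' h4 h5 (by decide) (by decide), h4,
        h5, h3' i j, hf.arr 9 (by decide), h₂, gainMatrix_apply]
    · have := cost_mulExp_le 3 4 8 5 h0'
      simp only [RExp.cost, NExp.cost]
      omega
  · linarith

theorem eval_quadraticFormExp {K : Matrix (Fin n) (Fin n) ℝ} {j : Fin m} (h0 : s.reg 0 = n)
    (hX : HasMat s 0 X) (h10 : HasMat s 10 K) (h5 : s.reg 5 = j) :
    quadraticFormExp.eval s = Xᵀ j ⬝ᵥ (K *ᵥ Xᵀ j) := by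
  rw [quadraticFormExp, eval_sum_var h0]
  refine Finset.sum_congr rfl fun a _ => ?_
  rw [eval_sum_var (s := s.setReg 7 a) (d := 0) h0, mulVec, dotProduct, Finset.mul_sum]
  refine Finset.sum_congr rfl fun b _ => ?_
  simp [RExp.eval, NExp.eval, Store.setReg, h5, hX _ _, h10 _ _]

theorem cost_quadraticFormExp_le (h0 : s.reg 0 = n) :
    quadraticFormExp.cost s ≤ 2 + n * (2 + n * 13 + 2) :=
  cost_sum_var_le h0 fun i => cost_sum_var_le (s := s.setReg 7 i) h0 fun _ => by rfl

theorem spec_lowerGains (h : Loaded X w k τ s) (hn : 0 < n) (hnm : n ≤ m)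
    (hL : (shiftedGram X w (lowerLevel n k τ)).PosDef)
    (hL' : (shiftedGram X w (lowerLevel n k τ + 1)).PosDef) :
    Spec {4, 5, 6} {2, 3, 4, 5, 6, 7, 8, 9, 10, 11} lowerGains s (400 * (m * n ^ 2))
      fun s' => HasVec s' 11 fun j =>
        Xᵀ j ⬝ᵥ (gainMatrix X w (lowerLevel n k τ) *ᵥ Xᵀ j) := by
  refine (Spec.seq (spec_lowerResolvents h hn hnm hL hL') fun s₁ hf₁ ⟨h6, h7, h3⟩ =>
    Spec.seq (spec_assembleGainMatrix (h.frame hf₁ (by decide) (by decide)).reg_n h6 h7 h3)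
    fun s₂ hf₂ h10 => spec_fillRow_zero (c := 2 + n * (2 + n * 13 + 2))
      (fun j => Xᵀ j ⬝ᵥ (gainMatrix X w (lowerLevel n k τ) *ᵥ Xᵀ j))
      ((h.frame hf₁ (by decide) (by decide)).frame hf₂ (by decide) (by decide)).reg_m
      fun s' j hf h5 => ?_).mono
    (by decide) (by decide) ?_ fun _ _ h => h
  · have h' := ((h.frame hf₁ (by decide) (by decide)).frame hf₂ (by decide) (by decide)).frame hf
      (by decide) (by decide)
    exact ⟨eval_quadraticFormExp h'.reg_n h'.mat (h10.frame hf (by decide)) h5,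
      cost_quadraticFormExp_le h'.reg_n⟩
  · obtain ⟨h₁, h₂, h₃⟩ := le_mul_sq hn hnm
    nlinarith

theorem lt_of_posDef_smul_one_sub_diagonal {T : ℝ}
    (h : (T • (1 : Matrix (Fin m) (Fin m) ℝ) - diagonal w).PosDef) (i : Fin m) : w i < T := by
  rw [smul_one_eq_diagonal, diagonal_sub, posDef_diagonal_iff] at h
  exact sub_pos.1 (h i)

theorem eval_upperGapExp (h : Loaded X w k τ s) :
    upperGapExp.eval s = ∑ i, (upperLevel n m k τ - w i)⁻¹
      - ∑ i, (upperLevel n m k τ + upperStep n m k - w i)⁻¹ := by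
  rw [upperGapExp, eval_sum_var h.reg_m, ← Finset.sum_sub_distrib]
  refine Finset.sum_congr rfl fun i _ => ?_
  have h' := h.setReg_seven i
  have h7 : (s.setReg 7 i).reg 7 = i := by simp [Store.setReg]
  rw [RExp.eval, h'.eval_gapInvExp _ h7, h'.eval_gapInvExp _ h7, RExp.eval, h'.eval_topExp,
    h'.eval_stepExp]

theorem cost_upperGapExp_le (h1 : s.reg 1 = m) : upperGapExp.cost s ≤ 2 + m * 95 :=
  cost_sum_var_le (c := 93) h1 fun _ => by rfl

theorem spec_upperGains (h : Loaded X w k τ s) (hk : n < k)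
    (hT : (upperLevel n m k τ • (1 : Matrix (Fin m) (Fin m) ℝ) - diagonal w).PosDef) :
    Spec {5} {12, 13} upperGains s (7 + m * 273) fun s' => HasVec s' 13 fun j =>
      upperGain ((1 : Matrix (Fin m) (Fin m) ℝ) j) (upperStep n m k) (diagonal w)
        (upperLevel n m k τ) := by
  refine (Spec.seq (R := ∅) (A := {12}) (K₁ := 5 + m * 95)
    (P := fun s' => s'.arr 12 0 0 = ∑ i, (upperLevel n m k τ - w i)⁻¹
      - ∑ i, (upperLevel n m k τ + upperStep n m k - w i)⁻¹)
    ⟨.setCell (by decide) _ _ _ _, ?_, ?_⟩ fun s₁ hf₁ h12 => spec_fillRow_zero (c := 174)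
      (fun j => upperGain ((1 : Matrix (Fin m) (Fin m) ℝ) j) (upperStep n m k) (diagonal w)
        (upperLevel n m k τ))
      (h.frame hf₁ (by decide) (by decide)).reg_m fun s' j hf h5 => ⟨?_, by rfl⟩).mono
    (by decide) (by decide) (by omega) fun _ _ h => h
  · have := cost_upperGapExp_le h.reg_m
    simp only [Prog.run, NExp.cost]
    omega
  · simp only [Prog.run, Store.setCell, NExp.eval, and_self, if_true, eval_upperGapExp h]
  · have h' := (h.frame hf₁ (by decide) (by decide)).frame hf (by decide) (by decide)
    rw [upperGain_one_diagonal (upperStep_pos m hk) (lt_of_posDef_smul_one_sub_diagonal hT)]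
    simp only [RExp.eval, NExp.eval, h'.eval_gapInvExp _ h5, h'.eval_topExp, h'.eval_stepExp,
      hf.arr 12 (by decide), h12]

theorem spec_selectIndex {lo up : Fin m → ℝ} (h1 : s.reg 1 = m) (hlo : HasVec s 11 lo)
    (hup : HasVec s 13 up) (hex : ∃ j, up j ≤ lo j) :
    Spec {5, 9} ∅ selectIndex s (2 + m * 10) fun s' => ∃ j : Fin m, s'.reg 9 = j ∧ up j ≤ lo j := by
  obtain ⟨j₀, hj₀⟩ := hex
  refine (Spec.loop (x := 5) (R := {5, 9}) (A := ∅) (K := 9)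
    (fun t s' => (∃ j : Fin m, (j : ℕ) < t ∧ up j ≤ lo j) →
      ∃ j : Fin m, s'.reg 9 = j ∧ up j ≤ lo j)
    (by decide) h1 (fun _ _ _ h => h) (fun ⟨_, hj, _⟩ => absurd hj (Nat.not_lt_zero _))
    fun t s₁ hf h5 h => ?_).mono
    subset_rfl subset_rfl le_rfl fun _ _ h => h ⟨j₀, j₀.2, hj₀⟩
  have hlo₁ := hlo.frame hf (by decide) t
  have hup₁ := hup.frame hf (by decide) t
  by_cases hle : up t ≤ lo t
  · have run_eq : (Prog.ifLe (.cell 13 (.lit 0) (.var 5)) (.cell 11 (.lit 0) (.var 5))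
        (.setN 9 (.var 5)) .skip).run s₁ = (s₁.setReg 9 t, 9) := by
      simp [Prog.run, RExp.eval, RExp.cost, NExp.eval, NExp.cost, h5, hlo₁, hup₁, hle]
    constructor <;> rw [run_eq]
    · exact .setReg (by decide) _ _
    · exact fun _ => ⟨t, by simp [Store.setReg], hle⟩
  · have run_eq : (Prog.ifLe (.cell 13 (.lit 0) (.var 5)) (.cell 11 (.lit 0) (.var 5))
        (.setN 9 (.var 5)) .skip).run s₁ = (s₁, 8) := by
      simp [Prog.run, RExp.eval, RExp.cost, NExp.eval, NExp.cost, h5, hlo₁, hup₁, hle]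
    constructor <;> rw [run_eq]
    · exact .refl _
    · exact Nat.le_succ 8
    · rintro ⟨j, hj, hj'⟩
      refine h ⟨j, (Nat.lt_succ_iff.1 hj).lt_of_ne fun hjt => hle ?_, hj'⟩
      rwa [← Fin.ext hjt]

theorem spec_updateWeight {lo up : Fin m → ℝ} {j : Fin m} (hlo : HasVec s 11 lo)
    (hup : HasVec s 13 up) (h9 : s.reg 9 = j) (hw : ∀ i : Fin m, s.arr 1 i 0 = w i) :
    Spec ∅ {1} updateWeight s 20 fun s' =>
      ∀ i : Fin m, s'.arr 1 i 0 = (w + Pi.single j ((up j + lo j) / 2)⁻¹ : Fin m → ℝ) i := by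
  refine ⟨.setCell (by decide) _ _ _ _, by rfl, fun i => ?_⟩
  rcases eq_or_ne i j with rfl | hij
  · simp [updateWeight, Prog.run, Store.setCell, RExp.eval, NExp.eval, h9, hlo i, hup i, hw]
  · simp [updateWeight, Prog.run, Store.setCell, RExp.eval, NExp.eval, h9, hw, hij,
      Fin.val_injective.ne hij]

theorem spec_iteration {V : Matrix (Fin m) (Fin n) ℝ} {R : Matrix (Fin n) (Fin n) ℝ}
    {st : State m n m} (h : Loaded (R * Vᵀ) st.s k τ s) (hn : 0 < n) (hnm : n ≤ m) (hk : n < k)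
    (hV : Vᵀ * V = 1) (hR : IsUnit R)
    (hst : BarrierInvariant V (1 : Matrix (Fin m) (Fin m) ℝ) k τ st) :
    Spec {4, 5, 6, 9} {1, 2, 3, 4, 5, 6, 7, 8, 9, 10, 11, 12, 13} iteration s (720 * (m * n ^ 2))
      fun s' => ∃ st', IsStep V (1 : Matrix (Fin m) (Fin m) ℝ) k τ st st' ∧
        ∀ j : Fin m, s'.arr 1 j 0 = st'.s j := by
  have hL := hst.lower_posDef
  have hL' := posDef_sub_add_smul_one hL zero_lt_one (hst.lowerPotential_lt_inv_one hk)
  rw [hst.A_eq] at hL hL'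
  have hT := hst.upper_posDef
  have B_eq : st.B = diagonal st.s := by
    rw [hst.B_eq, transpose_one, Matrix.one_mul, Matrix.mul_one]
  have hex := hst.exists_upperGain_le_lowerGain hn hk hV (by simp)
  refine (Spec.seq (spec_lowerGains h hn hnm (posDef_shiftedGram hV hR hL)
    (posDef_shiftedGram hV hR hL')) fun s₁ hf₁ h11 =>
    Spec.seq (spec_upperGains (h.frame hf₁ (by decide) (by decide)) hk (B_eq ▸ hT))
    fun s₂ hf₂ h13 => ?_).mono
    (K₁ := 400 * (m * n ^ 2) + (7 + m * 273 + (2 + m * 10 + 20)))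
    (R := {4, 5, 6} ∪ ({5} ∪ {5, 9}))
    (A := {2, 3, 4, 5, 6, 7, 8, 9, 10, 11} ∪ ({12, 13} ∪ {1}))
    (by decide) (by decide) ?_ fun _ _ h => h
  · have h₁ := h.frame hf₁ (by decide) (by decide)
    have h₂ := h₁.frame hf₂ (by decide) (by decide)
    have hlo : HasVec s₂ 11 fun j => lowerGain (V j) 1 st.A (lowerLevel n k τ) := fun j => by
      rw [hst.A_eq]
      exact (h11.frame hf₂ (by decide) j).trans (lowerGain_eq_gainMatrix hV hR _ _ j).symm
    rw [← B_eq] at h13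
    exact (Spec.seq (spec_selectIndex h₂.reg_m hlo h13 hex) fun s₃ hf₃ ⟨j, h9, hj⟩ =>
      (spec_updateWeight (hlo.frame hf₃ (by decide)) (h13.frame hf₃ (by decide)) h9
        (h₂.frame hf₃ (by decide) (by decide)).weights).mono subset_rfl subset_rfl le_rfl
        fun _ _ hw => ⟨_, ⟨j, hj, rfl⟩, hw⟩).mono (by decide) (by decide) le_rfl fun _ _ h => h
  · obtain ⟨-, h₂, h₃⟩ := le_mul_sq hn hnm
    have hm := hn.trans_le hnm
    omega

theorem spec_greedySelection {V : Matrix (Fin m) (Fin n) ℝ} {R : Matrix (Fin n) (Fin n) ℝ}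
    (hn : 0 < n) (hnm : n ≤ m) (hk : n < k) (hV : Vᵀ * V = 1) (hR : IsUnit R) :
    Spec {3, 4, 5, 6, 9} {1, 2, 3, 4, 5, 6, 7, 8, 9, 10, 11, 12, 13} greedySelection
      (initStore (R * Vᵀ) k) (723 * (k * m * n ^ 2)) fun s' => ∃ st,
        Reachable V (1 : Matrix (Fin m) (Fin m) ℝ) k k st ∧
          ∀ j : Fin m, s'.arr 1 j 0 = st.s j := by
  have hinit := Loaded.initStore (R * Vᵀ) k
  refine (Spec.loop (x := 3) (K := 720 * (m * n ^ 2)) (fun τ s' => ∃ st,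
      Reachable V (1 : Matrix (Fin m) (Fin m) ℝ) k τ st ∧ ∀ j : Fin m, s'.arr 1 j 0 = st.s j)
    (by decide) hinit.reg_k (fun _ _ _ h => h) ⟨_, .zero, hinit.weights⟩
    fun τ s' hf h3 ⟨st, hst, hw⟩ => ?_).mono subset_rfl subset_rfl ?_ fun _ _ h => h
  · have hloaded : Loaded (R * Vᵀ) st.s k τ s' :=
      ⟨(hf.reg 0 (by decide)).trans hinit.reg_n, (hf.reg 1 (by decide)).trans hinit.reg_m,
        (hf.reg 2 (by decide)).trans hinit.reg_k, h3, hinit.mat.frame hf (by decide), hw⟩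
    exact (spec_iteration hloaded hn hnm hk hV hR
      (hst.barrierInvariant hn hk (hn.trans_le hnm) one_row_ne_zero)).mono
      (by decide) subset_rfl le_rfl fun _ _ ⟨st', hstep, hw'⟩ => ⟨st', hst.succ hstep, hw'⟩
  · have hle : k ≤ k * m * n ^ 2 := by
      rw [mul_assoc]
      exact Nat.le_mul_of_pos_right k (by have := hn.trans_le hnm; positivity)
    calc 2 + k * (720 * (m * n ^ 2) + 1) = 720 * (k * m * n ^ 2) + k + 2 := by ring
      _ ≤ 723 * (k * m * n ^ 2) := by omega

end RealRAM

theorem theorem2_general :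
    ∃ (P : RealRAM.Prog) (C : ℕ), ∀ (n m k : ℕ), 0 < n → n < k →
      ∀ X : Matrix (Fin n) (Fin m) ℝ, X.rank = n →
        P.opCount X k ≤ C * (k * m * n ^ 2) ∧
        (∃ V : Matrix (Fin m) (Fin n) ℝ, IsRightSingularMatrix X V) ∧
        ∀ V : Matrix (Fin m) (Fin n) ℝ, IsRightSingularMatrix X V →
          IsGreedySelection V k (P.output X k) ∧
          ∀ S : Finset (Fin m), IsGreedySelection V k S →
            S.card ≤ k ∧
            (colSubmatrix X S).rank = n ∧
            spectralNorm₂ (pinv (colSubmatrix X S)) ^ 2 ≤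
              (1 + √((m : ℝ) / k)) ^ 2 * ((1 - √((n : ℝ) / k)) ^ 2)⁻¹ *
                spectralNorm₂ (pinv X) ^ 2 ∧
            frobeniusNorm (pinv (colSubmatrix X S)) ^ 2 ≤
              (1 + √((m : ℝ) / k)) ^ 2 * ((1 - √((n : ℝ) / k)) ^ 2)⁻¹ *
                frobeniusNorm (pinv X) ^ 2 := by
  refine ⟨RealRAM.greedySelection, 723, fun n m k hn hk X hX => ?_⟩
  have hnm : n ≤ m := hX ▸ X.rank_le_width
  have hm : 0 < m := hn.trans_le hnm
  have posDef_gram : (X * Xᵀ).PosDef := posDef_mul_transpose_of_rank_eq (by simpa using hX)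
  obtain ⟨V₀, hV₀⟩ := exists_isRightSingularMatrix posDef_gram
  refine ⟨?_, ⟨V₀, hV₀⟩, fun V hV => ⟨?_, fun S hS => ⟨hS.card_le hn hk hm,
    hS.rank_eq hn hk hm posDef_gram hV, hS.spectralNorm₂_pinv_sq_le hn hk hm posDef_gram hV,
    hS.frobeniusNorm_pinv_sq_le hn hk hm posDef_gram hV⟩⟩⟩
  · obtain ⟨R, hR, rfl⟩ := hV₀.exists_isUnit_mul_transpose
    exact (RealRAM.spec_greedySelection hn hnm hk hV₀.transpose_mul_self hR).cost_le
  · obtain ⟨R, hR, rfl⟩ := hV.exists_isUnit_mul_transpose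
    obtain ⟨st, hst, weights_eq⟩ :=
      (RealRAM.spec_greedySelection hn hnm hk hV.transpose_mul_self hR).post
    exact isGreedySelection_of_reachable hk hst fun i => by simp [RealRAM.Prog.output, weights_eq]

theorem theorem2 :
    -- a single program that carries out the algorithm, and a single constant
    ∃ (P : RealRAM.Prog) (C : ℕ), ∀ (n m k : ℕ), 0 < n → n < k → k ≤ m →
      ∀ X : Matrix (Fin n) (Fin m) ℝ, X.rank = n →
        P.opCount X k ≤ C * (k * m * n ^ 2) ∧
        (∃ V : Matrix (Fin m) (Fin n) ℝ, IsRightSingularMatrix X V) ∧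
        ∀ V : Matrix (Fin m) (Fin n) ℝ, IsRightSingularMatrix X V →
          IsGreedySelection V k (P.output X k) ∧
          ∀ S : Finset (Fin m), IsGreedySelection V k S →
            S.card ≤ k ∧
            (colSubmatrix X S).rank = n ∧
            spectralNorm₂ (pinv (colSubmatrix X S)) ^ 2 ≤
              (1 + √((m : ℝ) / k)) ^ 2 * ((1 - √((n : ℝ) / k)) ^ 2)⁻¹ *
                spectralNorm₂ (pinv X) ^ 2 ∧
            frobeniusNorm (pinv (colSubmatrix X S)) ^ 2 ≤
              (1 + √((m : ℝ) / k)) ^ 2 * ((1 - √((n : ℝ) / k)) ^ 2)⁻¹ *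
                frobeniusNorm (pinv X) ^ 2 := by
  obtain ⟨P, C, h⟩ := theorem2_general
  exact ⟨P, C, fun n m k hn hk _ => h n m k hn hk⟩
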